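/- Let $I$ and $J_c$ be finite index sets, and let $\mathcal X$, $\mathcal Y$, $\mathcal Z_i,\widetilde{\mathcal Z}_i$ ($i\in I$) and $\mathcal W_j$ ($j\in J_c$) be finite-dimensional real Hilbert spaces. Let $A:\mathcal X\to\mathcal Y$, $L_i:\mathcal X\to\mathcal Z_i$, $B_i:\mathcal Z_i\to\widetilde{\mathcal Z}_i$ and $K_j:\mathcal X\to\mathcal W_j$ be linear, $y\in\mathcal Y$, $\mu>0$ and $\mu_i>0$. Let each $\Psi_i:\mathcal Z_i\to\mathbb R$ be convex, lower semicontinuous, coercive ($\Psi_i(z)\to\infty$ as $\|z\|\to\infty$) and even. Let $C_0\subset\mathcal X$ and $C_j\subset\mathcal W_j$ be closed convex sets, put $S_a=\{x\in\mathcal X: K_jx\in C_j\ \text{for all } j\in J_c\}$, and assume $C_0\cap S_a\neq\emptyset$. Define $$(\Psi_i)_{B_i}(z)=\Psi_i(z)-\min_{v\in\mathcal Z_i}\Big[\Psi_i(v)+\tfrac12\|B_i(z-v)\|^2\Big],\qquad J(x)=\tfrac12\|y-Ax\|^2+\mu\sum_{i\in I}\mu_i\,(\Psi_i)_{B_i}(L_ix).$$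 Assume the overall convexity condition: $Q:=A^*A-\mu\sum_{i}\mu_iL_i^*B_i^*B_iL_i$ is positive semidefinite. Let $\sigma>0$, $\tau>0$ and $\kappa>1$ be such that $$\sigma\,\mathrm{Id}-\tfrac{\kappa}{2}A^*A-\mu\Big(\sum_{i}L_i^*L_i+\sum_{j}K_j^*K_j\Big)\ \text{is positive definite},\qquad \tau\ge\mu\Big(\tfrac{\kappa}{2}+\tfrac{2}{\kappa}\Big)\max_{i}\mu_i\|B_i\|_{\mathrm{op}}^2 .$$ Let $P_C$ denote the metric projection onto $C$ and $\operatorname{Prox}_{\gamma f}(x)=\operatorname{argmin}_v\,[f(v)+\frac1{2\gamma}\|v-x\|^2]$. On $\mathcal H=\mathcal X\times\prod_i\mathcal Z_i\times\prod_i\mathcal Z_i\times\prod_j\mathcal W_j$ define $T_{\mathrm{EA}}(x,(v_i),(w_i),(z_j))=(\xi,(\zeta_i),(\eta_i),(\varsigma_j))$ by $$\xi=P_{C_0}\Big[\big(\mathrm{Id}-\tfrac1\sigma Q\big)x+\tfrac1\sigma A^*y-\tfrac\mu\sigma\sum_i\big(\mu_iL_i^*B_i^*B_iv_i+L_i^*w_i\big)-\tfrac\mu\sigma\sum_jK_j^*z_j\Big],$$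 $$\zeta_i=\operatorname{Prox}_{\frac{\mu\mu_i}{\tau}\Psi_i}\Big[\tfrac{\mu\mu_i}{\tau}B_i^*B_iL_i(2\xi-x)+\big(\mathrm{Id}-\tfrac{\mu\mu_i}{\tau}B_i^*B_i\big)v_i\Big],$$ $$\eta_i=(\mathrm{Id}-\operatorname{Prox}_{\mu_i\Psi_i})(2L_i\xi-L_ix+w_i),\qquad \varsigma_j=(\mathrm{Id}-P_{C_j})(2K_j\xi-K_jx+z_j).$$ Let $h_0\in\mathcal H$ be any point whose $\mathcal X$-component lies in $C_0$, let $h_{k+1}=T_{\mathrm{EA}}(h_k)$ for $k\ge0$, and let $x_k$ be the $\mathcal X$-component of $h_k$. Then: (i) $x_k\in C_0$ for every $k\ge 0$. (ii) If $J$ has a minimizer over $C_0\cap S_a$ and the constraint qualification holds that some $\bar x\in\operatorname{ri}C_0$ satisfies $K_j\bar x\in\operatorname{ri}C_j$ for all $j\in J_c$ (where $\operatorname{ri}$ is the relative interior), then $(x_k)$ converges to a global minimizer of $J$ over $C_0\cap S_a$. -/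

import Mathlib

open Filter Topology

noncomputable section

namespace EALiGME

section Operators

variable {E : Type*} [NormedAddCommGroup E] [InnerProductSpace ℝ E]

/-- The metric projection `P_C x = argmin_{y ∈ C} ‖x - y‖`: it is the unique minimizer whenever
`C` is a nonempty closed convex subset of a finite dimensional space. -/
def proj (C : Set E) (x : E) : E :=
  Classical.epsilon fun p => p ∈ C ∧ ∀ y ∈ C, ‖x - p‖ ≤ ‖x - y‖

/-- The proximity operator `Prox_{γ f} x = argmin_v [f v + ‖v - x‖² / (2 γ)]`: it is the unique
minimizer whenever `f` is a convex lower semicontinuous function on a finite dimensional space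
and `γ > 0`. -/
def prox (γ : ℝ) (f : E → ℝ) (x : E) : E :=
  Classical.epsilon fun p =>
    ∀ v, f p + 1 / (2 * γ) * ‖p - x‖ ^ 2 ≤ f v + 1 / (2 * γ) * ‖v - x‖ ^ 2

/-- Positive definiteness of a self-adjoint operator. -/
def PosDef (T : E →ₗ[ℝ] E) : Prop :=
  T.IsSymmetric ∧ ∀ x, x ≠ 0 → 0 < inner ℝ (T x) x

/-- The generalized Moreau enhancement
`Ψ_B z = Ψ z - min_v [Ψ v + ‖B (z - v)‖² / 2]`. The minimum is attained, hence equal to the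
infimum, when `Ψ` is real-valued, convex and coercive on a finite dimensional space. -/
def gme {F : Type*} [NormedAddCommGroup F] [InnerProductSpace ℝ F]
    (Ψ : E → ℝ) (B : E →ₗ[ℝ] F) (z : E) : ℝ :=
  Ψ z - ⨅ v : E, (Ψ v + 1 / 2 * ‖B (z - v)‖ ^ 2)

end Operators

/-- The data of the model: observation operator `A`, observed signal `y`, weights `μ` and `μr i`,
tuning operators `B i`, analysis operators `L i`, seed functions `Ψ i` (real-valued, since their
domain is the whole space), early constraint set `C₀`, constraint sets `C j` with
operators `K j`. -/
structure Model {ι κ : Type*} (X Y : Type*) (Z Z' : ι → Type*) (W : κ → Type*)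
    [NormedAddCommGroup X] [InnerProductSpace ℝ X]
    [NormedAddCommGroup Y] [InnerProductSpace ℝ Y]
    [∀ i, NormedAddCommGroup (Z i)] [∀ i, InnerProductSpace ℝ (Z i)]
    [∀ i, NormedAddCommGroup (Z' i)] [∀ i, InnerProductSpace ℝ (Z' i)]
    [∀ j, NormedAddCommGroup (W j)] [∀ j, InnerProductSpace ℝ (W j)] where
  A : X →ₗ[ℝ] Y
  y : Y
  μ : ℝ
  μr : ι → ℝ
  B : ∀ i, Z i →ₗ[ℝ] Z' i
  L : ∀ i, X →ₗ[ℝ] Z i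
  Ψ : ∀ i, Z i → ℝ
  C₀ : Set X
  C : ∀ j, Set (W j)
  K : ∀ j, X →ₗ[ℝ] W j

namespace Model

variable {ι κ : Type*} [Fintype ι] [Fintype κ]
  {X Y : Type*} {Z Z' : ι → Type*} {W : κ → Type*}
  [NormedAddCommGroup X] [InnerProductSpace ℝ X] [FiniteDimensional ℝ X]
  [NormedAddCommGroup Y] [InnerProductSpace ℝ Y] [FiniteDimensional ℝ Y]
  [∀ i, NormedAddCommGroup (Z i)] [∀ i, InnerProductSpace ℝ (Z i)]
  [∀ i, FiniteDimensional ℝ (Z i)]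
  [∀ i, NormedAddCommGroup (Z' i)] [∀ i, InnerProductSpace ℝ (Z' i)]
  [∀ i, FiniteDimensional ℝ (Z' i)]
  [∀ j, NormedAddCommGroup (W j)] [∀ j, InnerProductSpace ℝ (W j)]
  [∀ j, FiniteDimensional ℝ (W j)]

/-- The cost function
`J x = ‖y - A x‖² / 2 + μ ∑ i, μ_i (Ψ_i)_{B_i} (L_i x)`. -/
def J (P : Model X Y Z Z' W) (x : X) : ℝ :=
  1 / 2 * ‖P.y - P.A x‖ ^ 2 + P.μ * ∑ i, P.μr i * gme (P.Ψ i) (P.B i) (P.L i x)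

/-- The asymptotic constraint set `S_a = ⋂ j, {x | K_j x ∈ C_j}`. -/
def asymptoticSet (P : Model X Y Z Z' W) : Set X :=
  ⋂ j, {x | P.K j x ∈ P.C j}

/-- The set of global minimizers of `J` over `C₀ ∩ S_a`. -/
def solutions (P : Model X Y Z Z' W) : Set X :=
  {x | x ∈ P.C₀ ∩ P.asymptoticSet ∧ ∀ x' ∈ P.C₀ ∩ P.asymptoticSet, P.J x ≤ P.J x'}

/-- The setting of the constrained problem. -/
structure Setting (P : Model X Y Z Z' W) : Prop where
  μ_pos : 0 < P.μ
  μr_pos : ∀ i, 0 < P.μr i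
  Ψ_convex : ∀ i, ConvexOn ℝ Set.univ (P.Ψ i)
  Ψ_lsc : ∀ i, LowerSemicontinuous (P.Ψ i)
  Ψ_coercive : ∀ i, Tendsto (P.Ψ i) (Bornology.cobounded (Z i)) atTop
  Ψ_even : ∀ i z, P.Ψ i (-z) = P.Ψ i z
  C_closed : ∀ j, IsClosed (P.C j)
  C_convex : ∀ j, Convex ℝ (P.C j)
  C₀_closed : IsClosed P.C₀
  C₀_convex : Convex ℝ P.C₀
  feasible : (P.C₀ ∩ P.asymptoticSet).Nonempty

/-- The operator `A* A - μ ∑ i, μ_i L_i* B_i* B_i L_i`. -/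
def Q (P : Model X Y Z Z' W) : X →ₗ[ℝ] X :=
  P.A.adjoint ∘ₗ P.A -
    P.μ • ∑ i, P.μr i • ((P.L i).adjoint ∘ₗ (P.B i).adjoint ∘ₗ P.B i ∘ₗ P.L i)

/-- The overall convexity condition: `A* A - μ ∑ i, μ_i L_i* B_i* B_i L_i` is positive
semidefinite. -/
def OverallConvexity (P : Model X Y Z Z' W) : Prop :=
  P.Q.IsPositive

/-- The constraint qualification: some `x` in the relative interior of `C₀` has `K_j x` in the
relative interior of `C_j` for all `j`. -/
def Qualified (P : Model X Y Z Z' W) : Prop :=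
  ∃ x ∈ intrinsicInterior ℝ P.C₀, ∀ j, P.K j x ∈ intrinsicInterior ℝ (P.C j)

/-- The admissible parameters `(σ, τ, k)` of the algorithm; the lower bound on `τ` by a maximum
over `i` is written as a family of lower bounds. -/
structure Admissible (P : Model X Y Z Z' W) (σ τ k : ℝ) : Prop where
  σ_pos : 0 < σ
  τ_pos : 0 < τ
  one_lt : 1 < k
  posDef : PosDef (σ • LinearMap.id - (k / 2) • (P.A.adjoint ∘ₗ P.A) -
    P.μ • (∑ i, (P.L i).adjoint ∘ₗ P.L i + ∑ j, (P.K j).adjoint ∘ₗ P.K j))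
  le_τ : ∀ i, P.μ * (k / 2 + 2 / k) * (P.μr i * ‖(P.B i).toContinuousLinearMap‖ ^ 2) ≤ τ

/-- The first component `ξ` of the iteration map. -/
def stepX (P : Model X Y Z Z' W) (σ : ℝ)
    (x : X) (v w : ∀ i, Z i) (z : ∀ j, W j) : X :=
  proj P.C₀ ((x - (1 / σ) • P.Q x) + (1 / σ) • P.A.adjoint P.y
    - (P.μ / σ) • ∑ i, (P.μr i • (P.L i).adjoint ((P.B i).adjoint (P.B i (v i)))
        + (P.L i).adjoint (w i))
    - (P.μ / σ) • ∑ j, (P.K j).adjoint (z j))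

/-- The iteration map `(x, v, w, z) ↦ (ξ, ζ, η, ς)` of the algorithm. -/
def T (P : Model X Y Z Z' W) (σ τ : ℝ) :
    X × (∀ i, Z i) × (∀ i, Z i) × (∀ j, W j) → X × (∀ i, Z i) × (∀ i, Z i) × (∀ j, W j) :=
  fun ⟨x, v, w, z⟩ =>
    let ξ := P.stepX σ x v w z
    (ξ,
     fun i => prox (P.μ * P.μr i / τ) (P.Ψ i)
      ((P.μ * P.μr i / τ) • (P.B i).adjoint (P.B i (P.L i ((2 : ℝ) • ξ - x)))
        + (v i - (P.μ * P.μr i / τ) • (P.B i).adjoint (P.B i (v i)))),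
     fun i =>
      let u := (2 : ℝ) • P.L i ξ - P.L i x + w i
      u - prox (P.μr i) (P.Ψ i) u,
     fun j =>
      let u := (2 : ℝ) • P.K j ξ - P.K j x + z j
      u - proj (P.C j) u)

end Model

end EALiGME

end

/-! The iteration is a primal-dual splitting whose fixed points encode optimality: `-force` is
normal to `C₀` at `x`, `v i` attains the minimum in the envelope at `L i x`, `w i` is a subgradient
of `μr i * Ψ i` at `L i x`, and `z j` is normal to `C j` at `K j x`.

Fixed points give solutions (`IsStep.mem_solutions`): testing the envelope at a competitor with the
old `v i` costs only `‖B i (L i d)‖ ^ 2` terms, which overall convexity pays for with `‖A d‖ ^ 2`.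
Conversely, at a solution the smooth part of `J` is linearized. The solution then minimizes a convex
problem, and separating the origin from the set of perturbations yields the dual variables; the
qualification makes the multiplier of the objective positive (`exists_multipliers`,
`exists_isStep_of_mem_solutions`).

For convergence, each step is written as variational inequalities (`IsStep`). Monotonicity of the
subdifferentials and normal cones, together with cocoercivity of the positive semidefinite operators
`Q` and `B* B` evaluated at the old point, gives Fejér monotonicity in the quadratic form `metric`,
with loss `decrease` (`IsStep.metric_le`). The conditions on `σ, τ, k` make `decrease` positive
definite (`Admissible.decrease_pos`), so the successive differences tend to zero. A cluster point is
then a fixed point by continuity, and Fejér monotonicity towards it gives convergence of the whole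
sequence. -/

set_option linter.unusedSectionVars false

/-! ### Separation, relative interiors and Lagrange multipliers -/

/-- Proper separation of the origin from a convex set in finite dimension. -/
theorem exists_linearMap_nonneg_of_zero_notMem {V : Type*} [NormedAddCommGroup V]
    [NormedSpace ℝ V] [FiniteDimensional ℝ V] {S : Set V} (hS : Convex ℝ S) (hne : S.Nonempty)
    (h0 : (0 : V) ∉ S) :
    ∃ f : V →ₗ[ℝ] ℝ, (∀ x ∈ S, 0 ≤ f x) ∧ ∃ x ∈ S, 0 < f x := by
  let W := Submodule.span ℝ S
  let S' : Set W := Subtype.val ⁻¹' S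
  have hS' : Convex ℝ S' := hS.linear_preimage W.subtype
  have hspan : Submodule.span ℝ S' = ⊤ := Submodule.span_span_coe_preimage
  obtain ⟨s, hs⟩ := hne
  have hsW : (⟨s, Submodule.subset_span hs⟩ : W) ∈ S' := hs
  -- The affine span of `S'` may be a hyperplane missing the origin; adjoining `0` makes it all of
  -- `W`, so that the hull has interior points.
  let H : Set W := convexHull ℝ (insert 0 S')
  have hH : Convex ℝ H := convex_convexHull ℝ _
  have hint : (interior H).Nonempty := by
    rw [hH.interior_nonempty_iff_affineSpan_eq_top, affineSpan_convexHull]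
    apply SetLike.coe_injective
    rw [affineSpan_insert_zero, hspan]
    rfl
  have hH0 : ∀ x ∈ H, ∃ t : ℝ, 0 ≤ t ∧ ∃ a ∈ S', x = t • a := by
    intro x hx
    rw [show H = convexHull ℝ (insert 0 S') from rfl, convexHull_insert ⟨_, hsW⟩,
      hS'.convexHull_eq, mem_convexJoin] at hx
    obtain ⟨z, hz, a, ha, hx⟩ := hx
    obtain rfl : z = 0 := hz
    obtain ⟨p, q, _, hq, _, rfl⟩ := hx
    exact ⟨q, hq, a, ha, by simp⟩
  -- Otherwise a small negative multiple of `s` is a nonnegative multiple of some `a ∈ S'`, and `0`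
  -- is a convex combination of `s` and `a`.
  have h0int : (0 : W) ∉ interior H := by
    intro h
    have hc : Tendsto (fun t : ℝ => (-t) • (⟨s, Submodule.subset_span hs⟩ : W)) (𝓝 0) (𝓝 0) := by
      have : Continuous (fun t : ℝ => (-t) • (⟨s, Submodule.subset_span hs⟩ : W)) := by fun_prop
      simpa using this.tendsto 0
    have hev := hc.eventually (mem_interior_iff_mem_nhds.1 h)
    obtain ⟨ε, hε, hball⟩ := Metric.eventually_nhds_iff.1 hev
    have hmem := @hball (ε / 2) (by simp [abs_of_pos hε]; linarith)
    obtain ⟨t, ht, a, ha, hta⟩ := hH0 _ hmem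
    have hta' : (-(ε / 2)) • s = t • (a : V) := congrArg Subtype.val hta
    apply h0
    have hpos : 0 < ε / 2 + t := by positivity
    have := hS hs ha (a := (ε / 2) / (ε / 2 + t)) (b := t / (ε / 2 + t)) (by positivity)
      (by positivity) (by field_simp)
    convert this using 1
    rw [div_eq_inv_mul (ε / 2), div_eq_inv_mul t, mul_smul, mul_smul, ← smul_add, ← hta',
      ← add_smul, add_neg_cancel, zero_smul, smul_zero]
  obtain ⟨f, hf⟩ := geometric_hahn_banach_open_point hH.interior isOpen_interior h0int
  rw [map_zero] at hf
  have hle : ∀ x ∈ S', f x ≤ 0 := by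
    intro x hx
    have hcl : x ∈ closure (interior H) := by
      rw [hH.closure_interior_eq_closure_of_nonempty_interior hint]
      exact subset_closure (subset_convexHull ℝ _ (Set.mem_insert_of_mem _ hx))
    exact closure_minimal (fun a ha => (hf a ha).le)
      (isClosed_le f.continuous continuous_const) hcl
  obtain ⟨g, hg⟩ := (f : W →ₗ[ℝ] ℝ).exists_extend
  have hgx : ∀ x (hx : x ∈ S), g x = f ⟨x, Submodule.subset_span hx⟩ := fun x hx =>
    LinearMap.congr_fun hg ⟨x, Submodule.subset_span hx⟩
  refine ⟨-g, fun x hx => ?_, ?_⟩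
  · have := hle ⟨x, Submodule.subset_span hx⟩ hx
    simp [hgx x hx, this]
  -- If the functional vanished on `S`, which spans `W`, it would be zero, although it is negative
  -- on the interior of `H`.
  · by_contra! hcon
    have hzero : Set.EqOn (f : W →ₗ[ℝ] ℝ) (0 : W →ₗ[ℝ] ℝ) S' := by
      intro x hx
      have h1 := hcon x hx
      have h2 := hgx x hx
      have h3 := hle x hx
      simp only [LinearMap.neg_apply, h2] at h1
      simp only [ContinuousLinearMap.coe_coe, LinearMap.zero_apply]
      exact le_antisymm h3 (by simpa using h1)
    have : (f : W →ₗ[ℝ] ℝ) = 0 := LinearMap.ext_on hspan hzero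
    obtain ⟨x, hx⟩ := hint
    have h1 := hf x hx
    have h2 : f x = 0 := LinearMap.congr_fun this x
    linarith

/-- A point of the relative interior can be moved slightly away from any other point. -/
theorem exists_pos_sub_smul_mem_of_mem_intrinsicInterior {V : Type*} [NormedAddCommGroup V]
    [NormedSpace ℝ V] {S : Set V} {x y : V} (hx : x ∈ intrinsicInterior ℝ S) (hy : y ∈ S) :
    ∃ t : ℝ, 0 < t ∧ x - t • (y - x) ∈ S := by
  obtain ⟨x', hx', rfl⟩ := mem_intrinsicInterior.1 hx
  have hya : y ∈ affineSpan ℝ S := subset_affineSpan ℝ S hy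
  have hmem : ∀ t : ℝ, (x' : V) - t • (y - x') ∈ affineSpan ℝ S := by
    intro t
    have := AffineMap.lineMap_mem (-t) x'.2 hya
    convert this using 1
    simp [AffineMap.lineMap_apply]
    abel
  let c : ℝ → affineSpan ℝ S := fun t => ⟨_, hmem t⟩
  have hc : Continuous c := by
    apply Continuous.subtype_mk
    fun_prop
  have hc0 : c 0 = x' := by apply Subtype.ext; simp [c]
  have hev : ∀ᶠ t in 𝓝 (0 : ℝ), c t ∈ (Subtype.val ⁻¹' S : Set (affineSpan ℝ S)) :=
    (hc.tendsto 0).eventually (by rw [hc0]; exact mem_interior_iff_mem_nhds.1 hx')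
  obtain ⟨ε, hε, hball⟩ := Metric.eventually_nhds_iff.1 hev
  exact ⟨ε / 2, by positivity, @hball (ε / 2) (by simp [abs_of_pos hε]; linarith)⟩

/-- A linear functional minimized over a set at a relative interior point is constant there. -/
theorem LinearMap.eq_of_le_of_mem_intrinsicInterior {V : Type*} [NormedAddCommGroup V]
    [NormedSpace ℝ V] {S : Set V} (f : V →ₗ[ℝ] ℝ) {x : V} (hx : x ∈ intrinsicInterior ℝ S)
    (hf : ∀ y ∈ S, f x ≤ f y) {y : V} (hy : y ∈ S) : f y = f x := by
  obtain ⟨t, ht, hmem⟩ := exists_pos_sub_smul_mem_of_mem_intrinsicInterior hx hy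
  have h1 := hf _ hmem
  have h2 := hf y hy
  simp only [map_sub, map_smul, smul_eq_mul] at h1
  nlinarith

theorem le_of_sum_le_sum_of_forall_mem {ι : Type*} [Fintype ι] {E : ι → Type*}
    {S : ∀ i, Set (E i)} (g : ∀ i, E i → ℝ) (x : ∀ i, E i) (hx : ∀ i, x i ∈ S i)
    (h : ∀ a : ∀ i, E i, (∀ i, a i ∈ S i) → ∑ i, g i (x i) ≤ ∑ i, g i (a i))
    (i : ι) (b : E i) (hb : b ∈ S i) : g i (x i) ≤ g i b := by
  classical
  have h1 := h (Function.update x i b) (by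
    intro j
    by_cases hj : j = i
    · subst hj; simpa using hb
    · simpa [Function.update_of_ne hj] using hx j)
  rw [← Finset.add_sum_erase _ (fun j => g j (x j)) (Finset.mem_univ i),
    ← Finset.add_sum_erase _ (fun j => g j (Function.update x i b j)) (Finset.mem_univ i)] at h1
  rw [Finset.sum_congr rfl (g := fun j => g j (x j)) (s₁ := Finset.univ.erase i)
    (f := fun j => g j (Function.update x i b j))
    (fun j hj => by rw [Function.update_of_ne (Finset.ne_of_mem_erase hj)])] at h1
  rw [Function.update_self] at h1
  exact le_of_add_le_add_right h1

theorem exists_inner_eq {E : Type*} [NormedAddCommGroup E] [InnerProductSpace ℝ E]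
    [FiniteDimensional ℝ E] (f : E →ₗ[ℝ] ℝ) : ∃ p : E, ∀ x, f x = inner ℝ p x :=
  ⟨(InnerProductSpace.toDual ℝ E).symm (LinearMap.toContinuousLinearMap f), fun x => by simp⟩

/-- Lagrange multipliers for a convex program with a linear objective part, composed convex
terms and composed set constraints under a relative interior qualification. -/
theorem exists_multipliers {ι κ : Type*} [Fintype ι] [Fintype κ]
    {X : Type*} {Z : ι → Type*} {W : κ → Type*}
    [NormedAddCommGroup X] [InnerProductSpace ℝ X]
    [∀ i, NormedAddCommGroup (Z i)] [∀ i, InnerProductSpace ℝ (Z i)]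
    [∀ i, FiniteDimensional ℝ (Z i)]
    [∀ j, NormedAddCommGroup (W j)] [∀ j, InnerProductSpace ℝ (W j)]
    [∀ j, FiniteDimensional ℝ (W j)]
    {C₀ : Set X} {C : ∀ j, Set (W j)} (hC₀ : Convex ℝ C₀) (hC : ∀ j, Convex ℝ (C j))
    {Φ : ∀ i, Z i → ℝ} (hΦ : ∀ i, ConvexOn ℝ Set.univ (Φ i))
    (L : ∀ i, X →ₗ[ℝ] Z i) (K : ∀ j, X →ₗ[ℝ] W j) (s : X →ₗ[ℝ] ℝ)
    {x : X} (hx : x ∈ C₀) (hKx : ∀ j, K j x ∈ C j)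
    (hmin : ∀ x' ∈ C₀, (∀ j, K j x' ∈ C j) →
      s x + ∑ i, Φ i (L i x) ≤ s x' + ∑ i, Φ i (L i x'))
    (hri : ∃ x' ∈ intrinsicInterior ℝ C₀, ∀ j, K j x' ∈ intrinsicInterior ℝ (C j)) :
    ∃ (p : ∀ i, Z i) (q : ∀ j, W j),
      (∀ i a, Φ i (L i x) + inner ℝ (p i) (a - L i x) ≤ Φ i a) ∧
      (∀ j, ∀ c ∈ C j, inner ℝ (q j) (c - K j x) ≤ 0) ∧
      ∀ x' ∈ C₀, 0 ≤ s (x' - x) + ∑ i, inner ℝ (p i) (L i (x' - x)) +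
        ∑ j, inner ℝ (q j) (K j (x' - x)) := by
  classical
  let V := (∀ i, Z i) × (∀ j, W j) × ℝ
  set m : ℝ := s x + ∑ i, Φ i (L i x) with hm
  -- Pairs of constraint residuals and strict upper bounds for the excess over the optimal value.
  -- Optimality of `x` says exactly that `0` is not attained.
  let S : Set V := {u | ∃ x' ∈ C₀, ∃ (a : ∀ i, Z i) (c : ∀ j, W j) (r : ℝ), (∀ j, c j ∈ C j) ∧
    s x' + ∑ i, Φ i (a i) - m < r ∧ u = (fun i => L i x' - a i, fun j => K j x' - c j, r)}
  have hS : Convex ℝ S := by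
    rintro _ ⟨x₁, hx₁, a₁, c₁, r₁, hc₁, hr₁, rfl⟩ _ ⟨x₂, hx₂, a₂, c₂, r₂, hc₂, hr₂, rfl⟩ α β hα hβ hαβ
    refine ⟨α • x₁ + β • x₂, hC₀ hx₁ hx₂ hα hβ hαβ, fun i => α • a₁ i + β • a₂ i,
      fun j => α • c₁ j + β • c₂ j, α * r₁ + β * r₂,
      fun j => hC j (hc₁ j) (hc₂ j) hα hβ hαβ, ?_, ?_⟩
    · have h1 : ∑ i, Φ i (α • a₁ i + β • a₂ i) ≤ α * ∑ i, Φ i (a₁ i) + β * ∑ i, Φ i (a₂ i) := by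
        rw [Finset.mul_sum, Finset.mul_sum, ← Finset.sum_add_distrib]
        refine Finset.sum_le_sum fun i _ => ?_
        simpa using (hΦ i).2 (Set.mem_univ (a₁ i)) (Set.mem_univ (a₂ i)) hα hβ hαβ
      simp only [map_add, map_smul, smul_eq_mul]
      have h2 : m = α * m + β * m := by rw [← add_mul, hαβ, one_mul]
      rcases hα.eq_or_lt with h | h
      · subst h
        obtain rfl : β = 1 := by linarith
        simp only [zero_mul, one_mul, zero_add] at *
        linarith
      · have h3 := mul_lt_mul_of_pos_left hr₁ h
        have h4 := mul_le_mul_of_nonneg_left hr₂.le hβ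
        linarith
    · refine Prod.ext ?_ (Prod.ext ?_ ?_)
      · funext i
        change α • (L i x₁ - a₁ i) + β • (L i x₂ - a₂ i) = _
        simp only [map_add, map_smul, smul_sub]
        abel
      · funext j
        change α • (K j x₁ - c₁ j) + β • (K j x₂ - c₂ j) = _
        simp only [map_add, map_smul, smul_sub]
        abel
      · rfl
  obtain ⟨x₀, hx₀, hKx₀⟩ := hri
  have hx₀C : x₀ ∈ C₀ := intrinsicInterior_subset hx₀
  have hKx₀C : ∀ j, K j x₀ ∈ C j := fun j => intrinsicInterior_subset (hKx₀ j)
  have hSne : S.Nonempty :=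
    ⟨_, x, hx, fun i => L i x, fun j => K j x, 1, hKx, by rw [hm]; simp, rfl⟩
  have h0 : (0 : V) ∉ S := by
    rintro ⟨x', hx', a, c, r, hc, hr, h⟩
    have h1 : ∀ i, a i = L i x' := fun i => by
      have := congrFun (congrArg Prod.fst h) i
      exact (sub_eq_zero.1 this.symm).symm
    have h2 : ∀ j, c j = K j x' := fun j => by
      have := congrFun (congrArg (fun u : V => u.2.1) h) j
      exact (sub_eq_zero.1 this.symm).symm
    have h3 : (0 : ℝ) = r := congrArg (fun u : V => u.2.2) h
    have h4 := hmin x' hx' (fun j => h2 j ▸ hc j)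
    simp only [h1] at hr
    linarith
  obtain ⟨f, hf, hfpos⟩ := exists_linearMap_nonneg_of_zero_notMem hS hSne h0
  choose p hp using fun i => exists_inner_eq
    (f ∘ₗ LinearMap.inl ℝ (∀ i, Z i) ((∀ j, W j) × ℝ) ∘ₗ LinearMap.single ℝ Z i)
  choose q hq using fun j => exists_inner_eq
    (f ∘ₗ LinearMap.inr ℝ (∀ i, Z i) ((∀ j, W j) × ℝ) ∘ₗ LinearMap.inl ℝ (∀ j, W j) ℝ ∘ₗ
      LinearMap.single ℝ W j)
  let ρ : ℝ := f (0, 0, 1)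
  have hfeq : ∀ (a : ∀ i, Z i) (c : ∀ j, W j) (r : ℝ),
      f (a, c, r) = ∑ i, inner ℝ (p i) (a i) + ∑ j, inner ℝ (q j) (c j) + r * ρ := by
    intro a c r
    have e1 : (a, c, r) = LinearMap.inl ℝ (∀ i, Z i) ((∀ j, W j) × ℝ) (∑ i, Pi.single i (a i)) +
        LinearMap.inr ℝ (∀ i, Z i) ((∀ j, W j) × ℝ)
          (LinearMap.inl ℝ (∀ j, W j) ℝ (∑ j, Pi.single j (c j))) + r • ((0, 0, 1) : V) := by
      rw [Finset.univ_sum_single, Finset.univ_sum_single]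
      simp
    rw [e1, map_add, map_add, map_sum, map_sum, map_sum, map_sum, map_sum, map_smul]
    congr 1
    congr 1
    · exact Finset.sum_congr rfl fun i _ => hp i (a i)
    · exact Finset.sum_congr rfl fun j _ => hq j (c j)
  have key : ∀ x' ∈ C₀, ∀ (a : ∀ i, Z i) (c : ∀ j, W j) (r : ℝ), (∀ j, c j ∈ C j) →
      s x' + ∑ i, Φ i (a i) - m < r →
      0 ≤ ∑ i, inner ℝ (p i) (L i x' - a i) + ∑ j, inner ℝ (q j) (K j x' - c j) + r * ρ := by
    intro x' hx' a c r hc hr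
    rw [← hfeq]
    exact hf _ ⟨x', hx', a, c, r, hc, hr, rfl⟩
  have hρ0 : 0 ≤ ρ := by
    have := key x hx (fun i => L i x) (fun j => K j x) 1 hKx (by rw [hm]; simp)
    simpa using this
  -- If `ρ = 0`, the separating functional vanishes on all of `S`, against properness: the free
  -- variables `a i` force `p = 0`, and at the relative interior points `x₀` and `K j x₀` the
  -- remaining linear functionals attain extrema over `C₀` and `C j`, hence are constant there.
  have hρ : 0 < ρ := by
    refine hρ0.lt_of_ne fun hρ => ?_
    have key0 : ∀ x' ∈ C₀, ∀ (a : ∀ i, Z i) (c : ∀ j, W j), (∀ j, c j ∈ C j) →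
        0 ≤ ∑ i, inner ℝ (p i) (L i x' - a i) + ∑ j, inner ℝ (q j) (K j x' - c j) := by
      intro x' hx' a c hc
      have := key x' hx' a c _ hc (lt_add_one _)
      rw [← hρ] at this
      simpa using this
    have hp0 : ∀ i, p i = 0 := by
      have h1 := key0 x₀ hx₀C (fun i => L i x₀ + p i) (fun j => K j x₀) hKx₀C
      simp only [sub_add_cancel_left, inner_neg_right, sub_self, inner_zero_right,
        Finset.sum_const_zero, add_zero, Finset.sum_neg_distrib, real_inner_self_eq_norm_sq] at h1
      have h2 : ∑ i, ‖p i‖ ^ 2 = 0 :=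
        le_antisymm (by linarith) (Finset.sum_nonneg fun i _ => by positivity)
      intro i
      have := (Finset.sum_eq_zero_iff_of_nonneg (fun i _ => by positivity)).1 h2 i
        (Finset.mem_univ i)
      simpa using this
    have key1 : ∀ x' ∈ C₀, ∀ (c : ∀ j, W j), (∀ j, c j ∈ C j) →
        0 ≤ ∑ j, inner ℝ (q j) (K j x' - c j) := by
      intro x' hx' c hc
      simpa [hp0] using key0 x' hx' (fun i => L i x') c hc
    let g : X →ₗ[ℝ] ℝ := ∑ j, (innerₛₗ ℝ (q j)) ∘ₗ K j
    have hg : ∀ x', g x' = ∑ j, inner ℝ (q j) (K j x') := fun x' => by simp [g]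
    have hgc : ∀ x' ∈ C₀, g x' = g x₀ := fun x' hx' =>
      g.eq_of_le_of_mem_intrinsicInterior hx₀ (fun y hy => by
        have := key1 y hy (fun j => K j x₀) hKx₀C
        simp only [inner_sub_right, Finset.sum_sub_distrib] at this
        rw [hg, hg]; linarith) hx'
    have hqc : ∀ j, ∀ c ∈ C j, inner ℝ (q j) c = inner ℝ (q j) (K j x₀) := by
      intro j c hc
      have h1 : ∀ j, ∀ c ∈ C j, -inner ℝ (q j) (K j x₀) ≤ -inner ℝ (q j) c := by
        refine le_of_sum_le_sum_of_forall_mem (S := C) (fun j c => -inner ℝ (q j) c)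
          (fun j => K j x₀) hKx₀C fun c hc => ?_
        have := key1 x₀ hx₀C c hc
        simp only [inner_sub_right, Finset.sum_sub_distrib] at this
        simp only [Finset.sum_neg_distrib]
        linarith
      have h2 := LinearMap.eq_of_le_of_mem_intrinsicInterior (-(innerₛₗ ℝ (q j))) (hKx₀ j)
        (fun y hy => by simpa using h1 j y hy) hc
      simpa using h2
    obtain ⟨u, ⟨x', hx', a, c, r, hc, hr, rfl⟩, hu⟩ := hfpos
    rw [hfeq, ← hρ] at hu
    simp only [hp0, inner_zero_left, Finset.sum_const_zero, inner_sub_right,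
      Finset.sum_sub_distrib, mul_zero, add_zero] at hu
    rw [← hg, hgc x' hx', hg, Finset.sum_congr rfl fun j _ => hqc j (c j) (hc j)] at hu
    simp at hu
  have keyle : ∀ x' ∈ C₀, ∀ (a : ∀ i, Z i) (c : ∀ j, W j), (∀ j, c j ∈ C j) →
      0 ≤ ρ⁻¹ * (∑ i, inner ℝ (p i) (L i x' - a i) + ∑ j, inner ℝ (q j) (K j x' - c j)) +
        (s x' + ∑ i, Φ i (a i) - m) := by
    intro x' hx' a c hc
    -- The bound on `r` is strict in `S`; letting `r` decrease to it gives the closed inequality.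
    refine le_of_forall_pos_le_add fun ε hε => ?_
    have h1 := key x' hx' a c _ hc (lt_add_of_pos_right _ hε)
    have h2 := mul_nonneg (inv_nonneg.2 hρ0) h1
    rw [mul_add, mul_comm _ ρ, inv_mul_cancel_left₀ hρ.ne'] at h2
    linarith
  refine ⟨fun i => ρ⁻¹ • p i, fun j => ρ⁻¹ • q j, ?_, ?_, ?_⟩
  · intro i a
    have := le_of_sum_le_sum_of_forall_mem (S := fun _ => Set.univ)
      (fun i a => Φ i a - ρ⁻¹ * inner ℝ (p i) a) (fun i => L i x) (fun _ => Set.mem_univ _)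
      (fun a _ => by
        have := keyle x hx a (fun j => K j x) hKx
        simp only [inner_sub_right, Finset.sum_sub_distrib, ← Finset.mul_sum, sub_self,
          inner_zero_right, Finset.sum_const_zero, add_zero] at this ⊢
        linarith) i a (Set.mem_univ _)
    simp only [inner_sub_right, real_inner_smul_left] at this ⊢
    linarith
  · intro j c hc
    have := le_of_sum_le_sum_of_forall_mem (S := C)
      (fun j c => -(ρ⁻¹ * inner ℝ (q j) c)) (fun j => K j x) hKx
      (fun c hc => by
        have := keyle x hx (fun i => L i x) c hc
        simp only [inner_sub_right, Finset.sum_sub_distrib, ← Finset.mul_sum, sub_self,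
          inner_zero_right, Finset.sum_const_zero, zero_add, Finset.sum_neg_distrib] at this ⊢
        linarith) j c hc
    simp only [inner_sub_right, real_inner_smul_left] at this ⊢
    linarith
  · intro x' hx'
    have := keyle x' hx' (fun i => L i x) (fun j => K j x) hKx
    simp only [map_sub, inner_sub_right, Finset.sum_sub_distrib, real_inner_smul_left,
      ← Finset.mul_sum] at this ⊢
    linarith

/-! ### Coercive quadratic forms and Fejér monotone sequences -/

/-- The constant is the minimum on the compact unit sphere, carried over by homogeneity. It turns
strict positivity of `decrease` into a uniform bound. -/
theorem exists_pos_mul_norm_sq_le {E : Type*} [NormedAddCommGroup E] [NormedSpace ℝ E]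
    [FiniteDimensional ℝ E] {q : E → ℝ} (hq : Continuous q)
    (hhom : ∀ (t : ℝ) x, q (t • x) = t ^ 2 * q x) (hpos : ∀ x, x ≠ 0 → 0 < q x) :
    ∃ c : ℝ, 0 < c ∧ ∀ x, c * ‖x‖ ^ 2 ≤ q x := by
  have hq0 : q 0 = 0 := by simpa using hhom 0 0
  rcases subsingleton_or_nontrivial E with hE | hE
  · exact ⟨1, one_pos, fun x => by rw [Subsingleton.elim x 0]; simp [hq0]⟩
  obtain ⟨e, he, hmin⟩ := (isCompact_sphere (0 : E) 1).exists_isMinOn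
    (NormedSpace.sphere_nonempty.2 zero_le_one) hq.continuousOn
  have he0 : e ≠ 0 := by
    rintro rfl
    simp at he
  refine ⟨q e, hpos e he0, fun x => ?_⟩
  rcases eq_or_ne x 0 with rfl | hx
  · simp [hq0]
  have hn : 0 < ‖x‖ := norm_pos_iff.2 hx
  have h1 : q e ≤ q (‖x‖⁻¹ • x) := hmin (by simp [norm_smul, hn.ne'])
  rw [hhom] at h1
  calc q e * ‖x‖ ^ 2 ≤ (‖x‖⁻¹ ^ 2 * q x) * ‖x‖ ^ 2 := by gcongr
    _ = q x := by field_simp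

/-- Convergence of the iterates of a continuous map that is Fejér monotone with respect to a
positive definite form with a coercive decrease. -/
theorem exists_tendsto_fixedPoint {E : Type*} [NormedAddCommGroup E] [NormedSpace ℝ E]
    [FiniteDimensional ℝ E] {T : E → E} (hT : Continuous T) {q R : E → ℝ} (hq : Continuous q)
    (hq0 : q 0 = 0) {c : ℝ} (hc : 0 < c) (hqc : ∀ x, c * ‖x‖ ^ 2 ≤ q x)
    (hRc : ∀ x, c * ‖x‖ ^ 2 ≤ R x)
    (hfejer : ∀ x p, T p = p → q (T x - p) ≤ q (x - p) - R (x - T x))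
    (hfix : ∃ p, T p = p) {u : ℕ → E} (hu : ∀ n, u (n + 1) = T (u n)) :
    ∃ p, T p = p ∧ Tendsto u atTop (𝓝 p) := by
  have hR0 : ∀ x, 0 ≤ R x := fun x => le_trans (by positivity) (hRc x)
  have hq0' : ∀ x, 0 ≤ q x := fun x => le_trans (by positivity) (hqc x)
  have hstep : ∀ p, T p = p → ∀ n, q (u (n + 1) - p) ≤ q (u n - p) - R (u n - u (n + 1)) := by
    intro p hp n
    rw [hu]
    exact hfejer _ _ hp
  have hanti : ∀ p, T p = p → Antitone fun n => q (u n - p) := fun p hp =>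
    antitone_nat_of_succ_le fun n => by linarith [hstep p hp n, hR0 (u n - u (n + 1))]
  have hconv : ∀ p, T p = p → ∃ l, Tendsto (fun n => q (u n - p)) atTop (𝓝 l) := fun p hp =>
    ⟨_, tendsto_atTop_ciInf (hanti p hp) ⟨0, by rintro _ ⟨n, rfl⟩; exact hq0' _⟩⟩
  obtain ⟨p, hp⟩ := hfix
  have hdiff : Tendsto (fun n => u n - u (n + 1)) atTop (𝓝 0) := by
    obtain ⟨l, hl⟩ := hconv p hp
    have h1 : Tendsto (fun n => (q (u n - p) - q (u (n + 1) - p)) / c) atTop (𝓝 0) := by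
      simpa using (hl.sub (hl.comp (tendsto_add_atTop_nat 1))).div_const c
    have h2 : Tendsto (fun n => ‖u n - u (n + 1)‖ ^ 2) atTop (𝓝 0) := by
      refine squeeze_zero (fun n => by positivity) (fun n => ?_) h1
      rw [le_div_iff₀ hc]
      linarith [hstep p hp n, hRc (u n - u (n + 1))]
    rw [tendsto_zero_iff_norm_tendsto_zero]
    simpa using h2.sqrt
  have hbdd : ∀ n, u n ∈ Metric.closedBall p (Real.sqrt (q (u 0 - p) / c)) := by
    intro n
    rw [mem_closedBall_iff_norm]
    apply Real.le_sqrt_of_sq_le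
    rw [le_div_iff₀ hc]
    linarith [hanti p hp (Nat.zero_le n), hqc (u n - p)]
  obtain ⟨a, -, φ, hφ, ha⟩ := tendsto_subseq_of_bounded Metric.isBounded_closedBall hbdd
  have haT : T a = a := by
    have h1 : Tendsto (fun n => u (φ n) - T (u (φ n))) atTop (𝓝 (a - T a)) :=
      ha.sub ((hT.tendsto a).comp ha)
    have h2 : Tendsto (fun n => u (φ n) - T (u (φ n))) atTop (𝓝 0) := by
      simpa [Function.comp_def, hu] using hdiff.comp hφ.tendsto_atTop
    exact (sub_eq_zero.1 (tendsto_nhds_unique h1 h2)).symm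
  -- The distance to the fixed point `a` converges along the whole sequence and tends to zero along
  -- a subsequence, so its limit is zero.
  refine ⟨a, haT, ?_⟩
  obtain ⟨l, hl⟩ := hconv a haT
  have hl0 : l = 0 := by
    have h1 : Tendsto (fun n => q (u (φ n) - a)) atTop (𝓝 (q (a - a))) :=
      (hq.tendsto _).comp (ha.sub_const a)
    rw [sub_self, hq0] at h1
    exact tendsto_nhds_unique (hl.comp hφ.tendsto_atTop) h1
  subst hl0
  have h2 : Tendsto (fun n => ‖u n - a‖ ^ 2) atTop (𝓝 0) := by
    refine squeeze_zero (fun n => by positivity) (fun n => ?_) (by simpa using hl.div_const c)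
    rw [le_div_iff₀ hc]
    linarith [hqc (u n - a)]
  rw [tendsto_iff_norm_sub_tendsto_zero]
  simpa using h2.sqrt

noncomputable section

namespace EALiGME

/-! ### First-order conditions, proximity operators and projections -/

section Operators

variable {E : Type*} [NormedAddCommGroup E] [InnerProductSpace ℝ E]

/-- Divide by `t` and let `t` decrease to `0`: the directional derivative test behind every
first-order condition below. -/
theorem nonneg_of_forall_mul_add_sq_nonneg {a b : ℝ}
    (h : ∀ t : ℝ, 0 < t → t ≤ 1 → 0 ≤ t * a + t ^ 2 * b) : 0 ≤ a := by
  have hlim : Tendsto (fun t : ℝ => a + t * b) (𝓝[>] 0) (𝓝 a) := by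
    have : Continuous fun t : ℝ => a + t * b := by fun_prop
    simpa using (this.tendsto 0).mono_left nhdsWithin_le_nhds
  refine ge_of_tendsto hlim ?_
  filter_upwards [Ioc_mem_nhdsGT (zero_lt_one' ℝ)] with t ht
  have := h t ht.1 ht.2
  have h2 : t * a + t ^ 2 * b = t * (a + t * b) := by ring
  rw [h2] at this
  exact nonneg_of_mul_nonneg_right this ht.1

/-- First-order optimality for a convex function plus a convex quadratic. -/
theorem le_add_inner_of_isMin {F : Type*} [NormedAddCommGroup F] [InnerProductSpace ℝ F]
    {f : E → ℝ} (hf : ConvexOn ℝ Set.univ f) (B : E →ₗ[ℝ] F) (b : F) {p : E}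
    (hp : ∀ v, f p + 1 / 2 * ‖b - B p‖ ^ 2 ≤ f v + 1 / 2 * ‖b - B v‖ ^ 2) (v : E) :
    f p + inner ℝ (b - B p) (B (v - p)) ≤ f v := by
  suffices 0 ≤ f v - f p - inner ℝ (b - B p) (B (v - p)) by linarith
  refine nonneg_of_forall_mul_add_sq_nonneg (b := 1 / 2 * ‖B (v - p)‖ ^ 2) fun t ht ht1 => ?_
  have h1 := hp (p + t • (v - p))
  have h2 := hf.2 (Set.mem_univ p) (Set.mem_univ v) (sub_nonneg.2 ht1) ht.le (by ring)
  rw [show (1 - t) • p + t • v = p + t • (v - p) by module] at h2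
  have h3 : b - B (p + t • (v - p)) = (b - B p) - t • B (v - p) := by
    simp only [map_add, map_smul]; abel
  rw [h3, norm_sub_sq_real (b - B p), inner_smul_right, norm_smul, mul_pow, Real.norm_eq_abs, sq_abs] at h1
  simp only [smul_eq_mul] at h2
  nlinarith

theorem isMin_of_le_add_inner {F : Type*} [NormedAddCommGroup F] [InnerProductSpace ℝ F]
    {f : E → ℝ} (B : E →ₗ[ℝ] F) (b : F) {p : E}
    (hp : ∀ v, f p + inner ℝ (b - B p) (B (v - p)) ≤ f v) (v : E) :
    f p + 1 / 2 * ‖b - B p‖ ^ 2 ≤ f v + 1 / 2 * ‖b - B v‖ ^ 2 := by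
  have h1 : b - B v = (b - B p) - B (v - p) := by simp
  rw [h1, norm_sub_sq_real (b - B p)]
  nlinarith [hp v, sq_nonneg ‖B (v - p)‖]

theorem exists_isMin_add_norm_sq [FiniteDimensional ℝ E] {F : Type*} [NormedAddCommGroup F]
    [InnerProductSpace ℝ F] {f : E → ℝ} (hf : ConvexOn ℝ Set.univ f)
    (hcoer : Tendsto f (Bornology.cobounded E) atTop) (B : E →ₗ[ℝ] F) (b : F) :
    ∃ p, ∀ v, f p + 1 / 2 * ‖b - B p‖ ^ 2 ≤ f v + 1 / 2 * ‖b - B v‖ ^ 2 := by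
  have : ProperSpace E := FiniteDimensional.proper_real E
  have hfc : Continuous f := continuousOn_univ.1 (hf.continuousOn isOpen_univ)
  have hB : Continuous B := B.continuous_of_finiteDimensional
  refine Continuous.exists_forall_le (f := fun v => f v + 1 / 2 * ‖b - B v‖ ^ 2)
    (by fun_prop) ?_
  rw [← Metric.cobounded_eq_cocompact]
  exact tendsto_atTop_mono (fun v => by have : 0 ≤ ‖b - B v‖ ^ 2 := by positivity
                                        linarith) hcoer

/-- Continuity and coercivity supply a minimizer, so the choice in `prox` is a genuine one. Scaling
by `γ` reduces the claim to the first-order condition with `B = id`: `x - prox γ f x` is a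
subgradient of `γ f`. -/
theorem prox_spec [FiniteDimensional ℝ E] {f : E → ℝ} (hf : ConvexOn ℝ Set.univ f)
    (hcoer : Tendsto f (Bornology.cobounded E) atTop) {γ : ℝ} (hγ : 0 < γ) (x v : E) :
    γ * f (prox γ f x) + inner ℝ (x - prox γ f x) (v - prox γ f x) ≤ γ * f v := by
  have hf' : ConvexOn ℝ Set.univ fun v => γ * f v := by
    simpa using hf.smul hγ.le
  have hiff : ∀ p v : E, f p + 1 / (2 * γ) * ‖p - x‖ ^ 2 ≤ f v + 1 / (2 * γ) * ‖v - x‖ ^ 2 ↔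
      γ * f p + 1 / 2 * ‖x - LinearMap.id (R := ℝ) p‖ ^ 2 ≤
        γ * f v + 1 / 2 * ‖x - LinearMap.id (R := ℝ) v‖ ^ 2 := by
    intro p v
    rw [← mul_le_mul_iff_right₀ hγ, norm_sub_rev x, norm_sub_rev x]
    simp only [LinearMap.id_coe, id_eq]
    have : ∀ a b : ℝ, γ * (a + 1 / (2 * γ) * b) = γ * a + 1 / 2 * b := by
      intro a b; field_simp
    rw [this, this]
  obtain ⟨p, hp⟩ := exists_isMin_add_norm_sq hf' (hcoer.const_mul_atTop hγ) LinearMap.id x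
  have hspec : ∀ v, f (prox γ f x) + 1 / (2 * γ) * ‖prox γ f x - x‖ ^ 2 ≤
      f v + 1 / (2 * γ) * ‖v - x‖ ^ 2 :=
    Classical.epsilon_spec (p := fun p => ∀ v, f p + 1 / (2 * γ) * ‖p - x‖ ^ 2 ≤
      f v + 1 / (2 * γ) * ‖v - x‖ ^ 2) ⟨p, fun v => (hiff p v).2 (hp v)⟩
  exact le_add_inner_of_isMin hf' LinearMap.id x (fun v => (hiff _ v).1 (hspec v)) v

theorem prox_eq_of_forall_le [FiniteDimensional ℝ E] {f : E → ℝ} (hf : ConvexOn ℝ Set.univ f)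
    (hcoer : Tendsto f (Bornology.cobounded E) atTop) {γ : ℝ} (hγ : 0 < γ) {x p : E}
    (hp : ∀ v, γ * f p + inner ℝ (x - p) (v - p) ≤ γ * f v) : prox γ f x = p := by
  have h1 := prox_spec hf hcoer hγ x p
  have h2 := hp (prox γ f x)
  have h3 : ‖prox γ f x - p‖ ^ 2 = inner ℝ (x - p) (prox γ f x - p) +
      inner ℝ (x - prox γ f x) (p - prox γ f x) := by
    rw [← neg_sub (prox γ f x) p, inner_neg_right, ← sub_eq_add_neg, ← inner_sub_left,
      ← real_inner_self_eq_norm_sq]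
    congr 1
    abel
  have h4 : ‖prox γ f x - p‖ ^ 2 ≤ 0 := by linarith
  rw [← sub_eq_zero, ← norm_eq_zero]
  exact pow_eq_zero_iff two_ne_zero |>.1 (le_antisymm h4 (by positivity))

/-- The hypothesis is firm nonexpansiveness; Cauchy–Schwarz then gives nonexpansiveness. It serves
continuity of `prox` and `proj`, and uniqueness of projections. -/
theorem norm_sub_le_of_inner_nonneg {x y p q : E}
    (h : 0 ≤ inner ℝ ((x - p) - (y - q)) (p - q)) : ‖p - q‖ ≤ ‖x - y‖ := by
  have h1 : ‖p - q‖ ^ 2 ≤ ‖x - y‖ * ‖p - q‖ := by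
    calc ‖p - q‖ ^ 2 ≤ inner ℝ (x - y) (p - q) := by
          rw [show (x - p) - (y - q) = (x - y) - (p - q) by abel, inner_sub_left,
            real_inner_self_eq_norm_sq] at h
          linarith
      _ ≤ _ := real_inner_le_norm _ _
  rcases (norm_nonneg (p - q)).eq_or_lt with h0 | h0
  · rw [← h0]; positivity
  · rw [sq] at h1
    exact le_of_mul_le_mul_right h1 h0

theorem continuous_prox [FiniteDimensional ℝ E] {f : E → ℝ} (hf : ConvexOn ℝ Set.univ f)
    (hcoer : Tendsto f (Bornology.cobounded E) atTop) {γ : ℝ} (hγ : 0 < γ) :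
    Continuous (prox γ f) := by
  refine LipschitzWith.continuous (K := 1) (LipschitzWith.of_dist_le_mul fun x y => ?_)
  rw [dist_eq_norm, dist_eq_norm, NNReal.coe_one, one_mul]
  apply norm_sub_le_of_inner_nonneg
  have h1 := prox_spec hf hcoer hγ x (prox γ f y)
  have h2 := prox_spec hf hcoer hγ y (prox γ f x)
  rw [← neg_sub (prox γ f x) (prox γ f y), inner_neg_right] at h1
  rw [inner_sub_left]
  linarith

theorem proj_mem_and_inner_le [FiniteDimensional ℝ E] {C : Set E} (hC : IsClosed C)
    (hconv : Convex ℝ C) (hne : C.Nonempty) (x : E) :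
    proj C x ∈ C ∧ ∀ v ∈ C, inner ℝ (x - proj C x) (v - proj C x) ≤ 0 := by
  have hinf : ∀ p ∈ C, (∀ y ∈ C, ‖x - p‖ ≤ ‖x - y‖) ↔ ‖x - p‖ = ⨅ w : C, ‖x - w‖ := by
    intro p hp
    have hne' : Nonempty C := hne.to_subtype
    have hbdd : BddBelow (Set.range fun w : C => ‖x - w‖) :=
      ⟨0, by rintro _ ⟨w, rfl⟩; positivity⟩
    constructor
    · intro h
      exact le_antisymm (le_ciInf fun w => h w w.2) (ciInf_le hbdd ⟨p, hp⟩)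
    · intro h y hy
      rw [h]
      exact ciInf_le hbdd ⟨y, hy⟩
  obtain ⟨p, hp, hpx⟩ := exists_norm_eq_iInf_of_complete_convex hne hC.isComplete hconv x
  have hspec : proj C x ∈ C ∧ ∀ y ∈ C, ‖x - proj C x‖ ≤ ‖x - y‖ :=
    Classical.epsilon_spec (p := fun p => p ∈ C ∧ ∀ y ∈ C, ‖x - p‖ ≤ ‖x - y‖)
      ⟨p, hp, (hinf p hp).2 hpx⟩
  exact ⟨hspec.1, (norm_eq_iInf_iff_real_inner_le_zero hconv hspec.1).1
    ((hinf _ hspec.1).1 hspec.2)⟩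

theorem proj_eq_of_forall_le [FiniteDimensional ℝ E] {C : Set E} (hC : IsClosed C)
    (hconv : Convex ℝ C) {x p : E} (hp : p ∈ C) (h : ∀ v ∈ C, inner ℝ (x - p) (v - p) ≤ 0) :
    proj C x = p := by
  obtain ⟨h1, h2⟩ := proj_mem_and_inner_le hC hconv ⟨p, hp⟩ x
  have h3 := h _ h1
  have h4 := h2 _ hp
  have h5 : ‖proj C x - p‖ ≤ ‖x - x‖ := by
    apply norm_sub_le_of_inner_nonneg
    rw [← neg_sub (proj C x) p, inner_neg_right] at h4
    rw [inner_sub_left]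
    linarith
  rw [← sub_eq_zero, ← norm_eq_zero]
  exact le_antisymm (by simpa using h5) (norm_nonneg _)

theorem continuous_proj [FiniteDimensional ℝ E] {C : Set E} (hC : IsClosed C)
    (hconv : Convex ℝ C) (hne : C.Nonempty) : Continuous (proj C) := by
  refine LipschitzWith.continuous (K := 1) (LipschitzWith.of_dist_le_mul fun x y => ?_)
  rw [dist_eq_norm, dist_eq_norm, NNReal.coe_one, one_mul]
  apply norm_sub_le_of_inner_nonneg
  obtain ⟨hx, hx'⟩ := proj_mem_and_inner_le hC hconv hne x
  obtain ⟨hy, hy'⟩ := proj_mem_and_inner_le hC hconv hne y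
  have h1 := hx' _ hy
  have h2 := hy' _ hx
  rw [← neg_sub (proj C x) (proj C y), inner_neg_right] at h1
  rw [inner_sub_left]
  linarith

end Operators

/-! ### Two-sided estimates for the generalized Moreau enhancement -/

section Enhancement

variable {E : Type*} [NormedAddCommGroup E] [InnerProductSpace ℝ E]
  {F : Type*} [NormedAddCommGroup F] [InnerProductSpace ℝ F]

theorem gme_eq_of_isMin {Ψ : E → ℝ} {B : E →ₗ[ℝ] F} {z v : E}
    (hv : ∀ u, Ψ v + 1 / 2 * ‖B z - B v‖ ^ 2 ≤ Ψ u + 1 / 2 * ‖B z - B u‖ ^ 2) :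
    gme Ψ B z = Ψ z - (Ψ v + 1 / 2 * ‖B z - B v‖ ^ 2) := by
  unfold gme
  simp only [map_sub]
  congr 1
  exact le_antisymm (ciInf_le ⟨_, by rintro _ ⟨u, rfl⟩; exact hv u⟩ v) (le_ciInf hv)

theorem sub_le_gme [FiniteDimensional ℝ E] {Ψ : E → ℝ} (hΨ : ConvexOn ℝ Set.univ Ψ)
    (hcoer : Tendsto Ψ (Bornology.cobounded E) atTop) (B : E →ₗ[ℝ] F) (z v : E) :
    Ψ z - (Ψ v + 1 / 2 * ‖B z - B v‖ ^ 2) ≤ gme Ψ B z := by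
  obtain ⟨p, hp⟩ := exists_isMin_add_norm_sq hΨ hcoer B (B z)
  rw [gme_eq_of_isMin hp]
  linarith [hp v]

/-- The subtracted envelope is convex, with the gradient `B* B (z - v)` at `z`. -/
theorem gme_le {Ψ : E → ℝ} {B : E →ₗ[ℝ] F} {z v : E}
    (hv : ∀ u, Ψ v + inner ℝ (B z - B v) (B (u - v)) ≤ Ψ u) (z' : E) :
    gme Ψ B z' ≤ Ψ z' - (Ψ v + 1 / 2 * ‖B z - B v‖ ^ 2)
      - inner ℝ (B z - B v) (B (z' - z)) := by
  have h : Ψ v + 1 / 2 * ‖B z - B v‖ ^ 2 + inner ℝ (B z - B v) (B (z' - z)) ≤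
      ⨅ u : E, (Ψ u + 1 / 2 * ‖B (z' - u)‖ ^ 2) := by
    refine le_ciInf fun u => ?_
    have h1 := hv u
    have h2 : B (u - v) = B (z' - z) + (B z - B v) - B (z' - u) := by
      simp only [map_sub]; abel
    rw [h2, inner_sub_right, inner_add_right, real_inner_self_eq_norm_sq] at h1
    -- Young's inequality absorbs the only term still depending on `u`, making the lower bound
    -- uniform over the infimum.
    have h3 : 0 ≤ ‖(B z - B v) - B (z' - u)‖ ^ 2 := by positivity
    rw [norm_sub_sq_real (B z - B v)] at h3
    linarith
  unfold gme
  linarith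

end Enhancement

/-! ### One step of the algorithm as variational inequalities -/

namespace Model

variable {ι κ : Type*} [Fintype ι] [Fintype κ]
  {X Y : Type*} {Z Z' : ι → Type*} {W : κ → Type*}
  [NormedAddCommGroup X] [InnerProductSpace ℝ X] [FiniteDimensional ℝ X]
  [NormedAddCommGroup Y] [InnerProductSpace ℝ Y] [FiniteDimensional ℝ Y]
  [∀ i, NormedAddCommGroup (Z i)] [∀ i, InnerProductSpace ℝ (Z i)]
  [∀ i, FiniteDimensional ℝ (Z i)]
  [∀ i, NormedAddCommGroup (Z' i)] [∀ i, InnerProductSpace ℝ (Z' i)]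
  [∀ i, FiniteDimensional ℝ (Z' i)]
  [∀ j, NormedAddCommGroup (W j)] [∀ j, InnerProductSpace ℝ (W j)]
  [∀ j, FiniteDimensional ℝ (W j)]

theorem inner_Q (P : Model X Y Z Z' W) (a d : X) :
    inner ℝ (P.Q a) d = inner ℝ (P.A a) (P.A d) -
      P.μ * ∑ i, P.μr i * inner ℝ (P.B i (P.L i a)) (P.B i (P.L i d)) := by
  simp [Q, inner_sub_left, real_inner_smul_left, sum_inner, LinearMap.adjoint_inner_left,
    LinearMap.sum_apply]

/-- The direction whose negative is followed by the projected step of the algorithm. -/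
def force (P : Model X Y Z Z' W) (x : X) (v w : ∀ i, Z i) (z : ∀ j, W j) : X :=
  P.Q x - P.A.adjoint P.y
    + P.μ • ∑ i, (P.μr i • (P.L i).adjoint ((P.B i).adjoint (P.B i (v i)))
        + (P.L i).adjoint (w i))
    + P.μ • ∑ j, (P.K j).adjoint (z j)

theorem inner_force (P : Model X Y Z Z' W) (x : X) (v w : ∀ i, Z i) (z : ∀ j, W j) (d : X) :
    inner ℝ (P.force x v w z) d = inner ℝ (P.A x - P.y) (P.A d) +
      P.μ * ∑ i, (-(P.μr i * inner ℝ (P.B i (P.L i x) - P.B i (v i)) (P.B i (P.L i d))) +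
        inner ℝ (w i) (P.L i d)) + P.μ * ∑ j, inner ℝ (z j) (P.K j d) := by
  simp only [force, inner_add_left, inner_sub_left, inner_Q, real_inner_smul_left, sum_inner,
    LinearMap.adjoint_inner_left, mul_sub, neg_sub, Finset.sum_add_distrib,
    Finset.sum_sub_distrib]
  ring

theorem stepX_eq (P : Model X Y Z Z' W) {σ : ℝ} (x : X) (v w : ∀ i, Z i) (z : ∀ j, W j) :
    P.stepX σ x v w z = proj P.C₀ (x - (1 / σ) • P.force x v w z) := by
  unfold stepX force
  congr 1
  simp only [div_eq_mul_inv, one_mul, mul_comm P.μ, smul_add, smul_sub, mul_smul]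
  abel

/-- The variational characterization of one step `(x, v, w, z) ↦ (ξ, ζ, η, ς)` of the algorithm. -/
structure IsStep (P : Model X Y Z Z' W) (σ τ : ℝ) (x : X) (v w : ∀ i, Z i) (z : ∀ j, W j)
    (ξ : X) (ζ η : ∀ i, Z i) (ς : ∀ j, W j) : Prop where
  mem : ξ ∈ P.C₀
  inner_le : ∀ x' ∈ P.C₀, inner ℝ (σ • (x - ξ) - P.force x v w z) (x' - ξ) ≤ 0
  le_v : ∀ i u, P.μ * P.μr i * P.Ψ i (ζ i) + (τ * inner ℝ (v i - ζ i) (u - ζ i) +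
    P.μ * P.μr i * inner ℝ (P.B i (P.L i ((2 : ℝ) • ξ - x)) - P.B i (v i)) (P.B i (u - ζ i))) ≤
      P.μ * P.μr i * P.Ψ i u
  le_w : ∀ i u, P.μr i * P.Ψ i ((2 : ℝ) • P.L i ξ - P.L i x + w i - η i) +
    inner ℝ (η i) (u - ((2 : ℝ) • P.L i ξ - P.L i x + w i - η i)) ≤ P.μr i * P.Ψ i u
  mem_z : ∀ j, (2 : ℝ) • P.K j ξ - P.K j x + z j - ς j ∈ P.C j
  le_z : ∀ j, ∀ c ∈ P.C j,
    inner ℝ (ς j) (c - ((2 : ℝ) • P.K j ξ - P.K j x + z j - ς j)) ≤ 0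

theorem Setting.C_nonempty {P : Model X Y Z Z' W} (hP : P.Setting) (j : κ) : (P.C j).Nonempty := by
  obtain ⟨x, -, hx⟩ := hP.feasible
  exact ⟨P.K j x, Set.mem_iInter.1 hx j⟩

theorem Setting.C₀_nonempty {P : Model X Y Z Z' W} (hP : P.Setting) : P.C₀.Nonempty :=
  hP.feasible.mono Set.inter_subset_left

theorem stepV_inner (P : Model X Y Z Z' W) {τ : ℝ} (hτ : 0 < τ) (i : ι) (l b b' u : Z i) :
    τ * inner ℝ ((P.μ * P.μr i / τ) • (P.B i).adjoint (P.B i l)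
        + (b - (P.μ * P.μr i / τ) • (P.B i).adjoint (P.B i b)) - b') (u - b') =
      τ * inner ℝ (b - b') (u - b') +
        P.μ * P.μr i * inner ℝ (P.B i l - P.B i b) (P.B i (u - b')) := by
  rw [show (P.μ * P.μr i / τ) • (P.B i).adjoint (P.B i l)
        + (b - (P.μ * P.μr i / τ) • (P.B i).adjoint (P.B i b)) - b' =
      (b - b') + (P.μ * P.μr i / τ) • (P.B i).adjoint (P.B i l - P.B i b) by
    rw [map_sub, smul_sub]; abel]
  rw [inner_add_left, real_inner_smul_left, LinearMap.adjoint_inner_left]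
  field_simp

theorem stepX_inner {σ : ℝ} (hσ : 0 < σ) (x ξ G d : X) :
    inner ℝ (σ • (x - ξ) - G) d = σ * inner ℝ (x - (1 / σ) • G - ξ) d := by
  rw [← real_inner_smul_left]
  congr 1
  rw [smul_sub, smul_sub, smul_sub, smul_smul, mul_one_div_cancel hσ.ne', one_smul]
  abel

theorem isStep_T {P : Model X Y Z Z' W} (hP : P.Setting) {σ τ : ℝ} (hσ : 0 < σ) (hτ : 0 < τ)
    (p : X × (∀ i, Z i) × (∀ i, Z i) × (∀ j, W j)) :
    P.IsStep σ τ p.1 p.2.1 p.2.2.1 p.2.2.2 (P.T σ τ p).1 (P.T σ τ p).2.1 (P.T σ τ p).2.2.1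
      (P.T σ τ p).2.2.2 := by
  obtain ⟨x, v, w, z⟩ := p
  obtain ⟨h1, h2⟩ := proj_mem_and_inner_le hP.C₀_closed hP.C₀_convex hP.C₀_nonempty
    (x - (1 / σ) • P.force x v w z)
  rw [← stepX_eq] at h1 h2
  refine ⟨h1, fun x' hx' => ?_, fun i u => ?_, fun i u => ?_, fun j => ?_, fun j c hc => ?_⟩
  · rw [stepX_inner hσ]
    exact mul_nonpos_of_nonneg_of_nonpos hσ.le (h2 x' hx')
  · have h := prox_spec (hP.Ψ_convex i) (hP.Ψ_coercive i)
      (div_pos (mul_pos hP.μ_pos (hP.μr_pos i)) hτ)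
      ((P.μ * P.μr i / τ) • (P.B i).adjoint (P.B i (P.L i ((2 : ℝ) • P.stepX σ x v w z - x)))
        + (v i - (P.μ * P.μr i / τ) • (P.B i).adjoint (P.B i (v i)))) u
    have h' := mul_le_mul_of_nonneg_left h hτ.le
    rw [mul_add, stepV_inner P hτ, ← mul_assoc, ← mul_assoc, mul_div_cancel₀ _ hτ.ne'] at h'
    exact h'
  · have h := prox_spec (hP.Ψ_convex i) (hP.Ψ_coercive i) (hP.μr_pos i)
      ((2 : ℝ) • P.L i (P.stepX σ x v w z) - P.L i x + w i) u
    simp only [T, sub_sub_cancel]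
    exact h
  · simp only [T, sub_sub_cancel]
    exact (proj_mem_and_inner_le (hP.C_closed j) (hP.C_convex j) (hP.C_nonempty j) _).1
  · simp only [T, sub_sub_cancel]
    exact (proj_mem_and_inner_le (hP.C_closed j) (hP.C_convex j) (hP.C_nonempty j) _).2 c hc

/-- Projections and proximal points are the unique solutions of their variational inequalities. This
lets a stationary tuple built from multipliers count as a fixed point of `T`. -/
theorem IsStep.T_eq {P : Model X Y Z Z' W} (hP : P.Setting) {σ τ : ℝ} (hσ : 0 < σ) (hτ : 0 < τ)
    {x ξ : X} {v w ζ η : ∀ i, Z i} {z ς : ∀ j, W j} (h : P.IsStep σ τ x v w z ξ ζ η ς) :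
    P.T σ τ (x, v, w, z) = (ξ, ζ, η, ς) := by
  have h1 : P.stepX σ x v w z = ξ := by
    rw [stepX_eq]
    refine proj_eq_of_forall_le hP.C₀_closed hP.C₀_convex h.mem fun u hu => ?_
    have := h.inner_le u hu
    rw [stepX_inner hσ] at this
    exact nonpos_of_mul_nonpos_right this hσ
  simp only [T, h1]
  refine Prod.ext rfl (Prod.ext (funext fun i => ?_) (Prod.ext (funext fun i => ?_)
    (funext fun j => ?_)))
  · refine prox_eq_of_forall_le (hP.Ψ_convex i) (hP.Ψ_coercive i)
      (div_pos (mul_pos hP.μ_pos (hP.μr_pos i)) hτ) fun u => ?_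
    have := h.le_v i u
    rw [← stepV_inner P hτ] at this
    refine le_of_mul_le_mul_left ?_ hτ
    rw [mul_add, ← mul_assoc, ← mul_assoc, mul_div_cancel₀ _ hτ.ne']
    exact this
  · have := prox_eq_of_forall_le (x := (2 : ℝ) • P.L i ξ - P.L i x + w i)
      (p := (2 : ℝ) • P.L i ξ - P.L i x + w i - η i) (hP.Ψ_convex i)
      (hP.Ψ_coercive i) (hP.μr_pos i) (fun u => by
        rw [sub_sub_cancel]; exact h.le_w i u)
    simp only [this, sub_sub_cancel]
  · have := proj_eq_of_forall_le (x := (2 : ℝ) • P.K j ξ - P.K j x + z j)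
      (p := (2 : ℝ) • P.K j ξ - P.K j x + z j - ς j) (hP.C_closed j) (hP.C_convex j)
      (h.mem_z j) (fun u hu => by
        rw [sub_sub_cancel]; exact h.le_z j u hu)
    simp only [this, sub_sub_cancel]

theorem continuous_T {P : Model X Y Z Z' W} (hP : P.Setting) {σ τ : ℝ} (hτ : 0 < τ) :
    Continuous (P.T σ τ) := by
  have hproj₀ : Continuous (proj P.C₀) :=
    continuous_proj hP.C₀_closed hP.C₀_convex hP.C₀_nonempty
  have hproj : ∀ j, Continuous (proj (P.C j)) := fun j =>
    continuous_proj (hP.C_closed j) (hP.C_convex j) (hP.C_nonempty j)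
  have hprox : ∀ i γ, 0 < γ → Continuous (prox γ (P.Ψ i)) := fun i γ hγ =>
    continuous_prox (hP.Ψ_convex i) (hP.Ψ_coercive i) hγ
  have hQ := P.Q.continuous_of_finiteDimensional
  have hL := fun i => (P.L i).continuous_of_finiteDimensional
  have hL' := fun i => (P.L i).adjoint.continuous_of_finiteDimensional
  have hB := fun i => (P.B i).continuous_of_finiteDimensional
  have hB' := fun i => (P.B i).adjoint.continuous_of_finiteDimensional
  have hK := fun j => (P.K j).continuous_of_finiteDimensional
  have hK' := fun j => (P.K j).adjoint.continuous_of_finiteDimensional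
  have hX : Continuous fun p : X × (∀ i, Z i) × (∀ i, Z i) × (∀ j, W j) =>
      P.stepX σ p.1 p.2.1 p.2.2.1 p.2.2.2 := by
    unfold stepX
    fun_prop
  refine hX.prodMk (Continuous.prodMk ?_ (Continuous.prodMk ?_ ?_))
  · refine continuous_pi fun i => (hprox i _
      (div_pos (mul_pos hP.μ_pos (hP.μr_pos i)) hτ)).comp ?_
    fun_prop
  · refine continuous_pi fun i => ?_
    have := hprox i _ (hP.μr_pos i)
    fun_prop
  · refine continuous_pi fun j => ?_
    fun_prop

/-! ### Fixed points and solutions -/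

theorem mem_asymptoticSet {P : Model X Y Z Z' W} {x : X} :
    x ∈ P.asymptoticSet ↔ ∀ j, P.K j x ∈ P.C j := Set.mem_iInter

theorem IsStep.isMin {P : Model X Y Z Z' W} (hP : P.Setting) {σ τ : ℝ} {x : X}
    {v w : ∀ i, Z i} {z : ∀ j, W j} (h : P.IsStep σ τ x v w z x v w z) (i : ι) (u : Z i) :
    P.Ψ i (v i) + inner ℝ (P.B i (P.L i x) - P.B i (v i)) (P.B i (u - v i)) ≤ P.Ψ i u := by
  have := h.le_v i u
  rw [two_smul, add_sub_cancel_right, sub_self, inner_zero_left, mul_zero, zero_add,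
    ← mul_add] at this
  exact le_of_mul_le_mul_left this (mul_pos hP.μ_pos (hP.μr_pos i))

/-- A stationary point of the algorithm solves the constrained problem. -/
theorem IsStep.mem_solutions {P : Model X Y Z Z' W} (hP : P.Setting) (hconv : P.OverallConvexity)
    {σ τ : ℝ} {x : X} {v w : ∀ i, Z i} {z : ∀ j, W j} (h : P.IsStep σ τ x v w z x v w z) :
    x ∈ P.solutions := by
  have hz : ∀ j, (2 : ℝ) • P.K j x - P.K j x + z j - z j = P.K j x := fun j => by
    rw [two_smul]; abel
  have hw : ∀ i, (2 : ℝ) • P.L i x - P.L i x + w i - w i = P.L i x := fun i => by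
    rw [two_smul]; abel
  have hKx : ∀ j, P.K j x ∈ P.C j := fun j => by simpa only [hz] using h.mem_z j
  refine ⟨⟨h.mem, mem_asymptoticSet.2 hKx⟩, fun x' hx' => ?_⟩
  obtain ⟨hx'C, hx'K⟩ := hx'
  rw [mem_asymptoticSet] at hx'K
  set d := x' - x with hd
  have hx'd : x' = x + d := by rw [hd]; abel
  have hforce := h.inner_le x' hx'C
  rw [sub_self, smul_zero, zero_sub, inner_neg_left, ← hd, inner_force] at hforce
  have hK : ∑ j, inner ℝ (z j) (P.K j d) ≤ 0 := Finset.sum_nonpos fun j _ => by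
    have := h.le_z j _ (hx'K j)
    rwa [hz, ← map_sub] at this
  have hK' := mul_nonpos_of_nonneg_of_nonpos hP.μ_pos.le hK
  -- Overall convexity: `‖A d‖ ^ 2` dominates the quadratic losses collected in `hterm`.
  have hQ : 0 ≤ inner ℝ (P.Q d) d := hconv.re_inner_nonneg_left d
  rw [inner_Q, real_inner_self_eq_norm_sq, Finset.sum_congr rfl fun i _ => by
    rw [real_inner_self_eq_norm_sq]] at hQ
  have hA : ‖P.y - P.A x'‖ ^ 2 = ‖P.y - P.A x‖ ^ 2 + 2 * inner ℝ (P.A x - P.y) (P.A d) +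
      ‖P.A d‖ ^ 2 := by
    rw [hx'd, map_add, ← sub_sub, norm_sub_sq_real (P.y - P.A x), ← neg_sub (P.A x) P.y,
      inner_neg_left]
    ring
  have hterm : ∀ i, P.μr i * gme (P.Ψ i) (P.B i) (P.L i x) +
      (-(P.μr i * inner ℝ (P.B i (P.L i x) - P.B i (v i)) (P.B i (P.L i d))) +
        inner ℝ (w i) (P.L i d)) - 1 / 2 * (P.μr i * ‖P.B i (P.L i d)‖ ^ 2) ≤
      P.μr i * gme (P.Ψ i) (P.B i) (P.L i x') := by
    intro i
    have h1 := gme_eq_of_isMin (isMin_of_le_add_inner (P.B i) (P.B i (P.L i x)) (h.isMin hP i))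
    -- The minimizer `v i` for `L i x` serves as trial point for the envelope at `L i x'`.
    have h2 := sub_le_gme (hP.Ψ_convex i) (hP.Ψ_coercive i) (P.B i) (P.L i x') (v i)
    have h3 := h.le_w i (P.L i x')
    rw [hw, ← map_sub, ← hd] at h3
    have h4 : ‖P.B i (P.L i x') - P.B i (v i)‖ ^ 2 = ‖P.B i (P.L i x) - P.B i (v i)‖ ^ 2 +
        2 * inner ℝ (P.B i (P.L i x) - P.B i (v i)) (P.B i (P.L i d)) +
        ‖P.B i (P.L i d)‖ ^ 2 := by
      rw [hx'd, map_add, map_add, add_sub_right_comm, norm_add_sq_real]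
    rw [h4] at h2
    rw [h1]
    have := mul_le_mul_of_nonneg_left h2 (hP.μr_pos i).le
    linarith
  have hsum := mul_le_mul_of_nonneg_left (Finset.sum_le_sum fun i (_ : i ∈ Finset.univ) => hterm i)
    hP.μ_pos.le
  rw [Finset.sum_sub_distrib, Finset.sum_add_distrib, ← Finset.mul_sum] at hsum
  unfold J
  rw [hA]
  linarith

/-- Under the constraint qualification every solution extends to a stationary point. -/
theorem exists_isStep_of_mem_solutions {P : Model X Y Z Z' W} (hP : P.Setting)
    (hqual : P.Qualified) {x : X} (hx : x ∈ P.solutions) (σ τ : ℝ) :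
    ∃ (v w : ∀ i, Z i) (z : ∀ j, W j), P.IsStep σ τ x v w z x v w z := by
  obtain ⟨⟨hxC, hxK⟩, hmin⟩ := hx
  rw [mem_asymptoticSet] at hxK
  choose v hv using fun i => exists_isMin_add_norm_sq (hP.Ψ_convex i) (hP.Ψ_coercive i) (P.B i)
    (P.B i (P.L i x))
  -- The resulting `s` is the derivative at `x` of the smooth part of `J`, data term minus
  -- envelopes; the convex terms `Ψ i` stay unlinearized.
  have hv' := fun i => le_add_inner_of_isMin (hP.Ψ_convex i) (P.B i) (P.B i (P.L i x)) (hv i)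
  let s : X →ₗ[ℝ] ℝ := innerₛₗ ℝ (P.force x v 0 0)
  have hs : ∀ d, s d = inner ℝ (P.A x - P.y) (P.A d) -
      P.μ * ∑ i, P.μr i * inner ℝ (P.B i (P.L i x) - P.B i (v i)) (P.B i (P.L i d)) := by
    intro d
    simp [s, inner_force, sub_eq_add_neg]
  obtain ⟨p, q, hp, hq, hstat⟩ := exists_multipliers hP.C₀_convex hP.C_convex
    (Φ := fun i u => P.μ * P.μr i * P.Ψ i u)
    (fun i => by
      simpa using (hP.Ψ_convex i).smul (mul_pos hP.μ_pos (hP.μr_pos i)).le)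
    P.L P.K s hxC hxK (fun x' hx' hx'K => by
      set d := x' - x with hd
      suffices 0 ≤ s d + ∑ i, (P.μ * P.μr i * P.Ψ i (P.L i x') -
          P.μ * P.μr i * P.Ψ i (P.L i x)) by
        rw [Finset.sum_sub_distrib, hd, map_sub] at this
        linarith
      refine nonneg_of_forall_mul_add_sq_nonneg (b := 1 / 2 * ‖P.A d‖ ^ 2) fun t ht ht1 => ?_
      have hcomb : (1 - t) • x + t • x' = x + t • d := by rw [hd]; module
      have hmem : x + t • d ∈ P.C₀ := by
        rw [← hcomb]
        exact hP.C₀_convex hxC hx' (sub_nonneg.2 ht1) ht.le (by ring)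
      have hmemK : ∀ j, P.K j (x + t • d) ∈ P.C j := fun j => by
        rw [← hcomb, map_add, map_smul, map_smul]
        exact hP.C_convex j (hxK j) (hx'K j) (sub_nonneg.2 ht1) ht.le (by ring)
      have hJ := hmin _ ⟨hmem, mem_asymptoticSet.2 hmemK⟩
      have hA : ‖P.y - P.A (x + t • d)‖ ^ 2 = ‖P.y - P.A x‖ ^ 2 +
          2 * (t * inner ℝ (P.A x - P.y) (P.A d)) + t ^ 2 * ‖P.A d‖ ^ 2 := by
        rw [map_add, map_smul, ← sub_sub, norm_sub_sq_real (P.y - P.A x), ← neg_sub (P.A x) P.y,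
          inner_neg_left, inner_smul_right, norm_smul, mul_pow, Real.norm_eq_abs, sq_abs]
        ring
      have hterm : ∀ i, P.μr i * gme (P.Ψ i) (P.B i) (P.L i (x + t • d)) ≤
          P.μr i * gme (P.Ψ i) (P.B i) (P.L i x) +
          t * ((P.μr i * P.Ψ i (P.L i x') - P.μr i * P.Ψ i (P.L i x)) -
            P.μr i * inner ℝ (P.B i (P.L i x) - P.B i (v i)) (P.B i (P.L i d))) := by
        intro i
        have h1 := gme_eq_of_isMin (hv i)
        have h2 := gme_le (hv' i) (P.L i (x + t • d))
        have h3 := (hP.Ψ_convex i).2 (Set.mem_univ (P.L i x)) (Set.mem_univ (P.L i x'))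
          (sub_nonneg.2 ht1) ht.le (by ring)
        rw [← map_smul, ← map_smul, ← map_add, hcomb, smul_eq_mul, smul_eq_mul] at h3
        rw [← map_sub (P.L i), add_sub_cancel_left, map_smul, map_smul, inner_smul_right] at h2
        have h4 := mul_le_mul_of_nonneg_left (h2.trans
          (sub_le_sub_right (sub_le_sub_right h3 _) _)) (hP.μr_pos i).le
        rw [h1]
        linarith
      have hsum := mul_le_mul_of_nonneg_left
        (Finset.sum_le_sum fun i (_ : i ∈ Finset.univ) => hterm i) hP.μ_pos.le
      rw [Finset.sum_add_distrib, ← Finset.mul_sum, Finset.sum_sub_distrib] at hsum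
      have hΨ : ∑ i, (P.μ * P.μr i * P.Ψ i (P.L i x') - P.μ * P.μr i * P.Ψ i (P.L i x)) =
          P.μ * ∑ i, (P.μr i * P.Ψ i (P.L i x') - P.μr i * P.Ψ i (P.L i x)) := by
        rw [Finset.mul_sum]
        exact Finset.sum_congr rfl fun i _ => by ring
      rw [hΨ, hs]
      unfold J at hJ
      rw [hA] at hJ
      linarith) hqual
  have hμ := hP.μ_pos
  -- The algorithm carries its dual variables with a factor `μ` in front, hence the rescaling.
  refine ⟨v, fun i => P.μ⁻¹ • p i, fun j => P.μ⁻¹ • q j, hxC, fun x' hx' => ?_, fun i u => ?_,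
    fun i u => ?_, fun j => ?_, fun j c hc => ?_⟩
  · have h1 := hstat x' hx'
    rw [sub_self, smul_zero, zero_sub, inner_neg_left, inner_force]
    rw [hs] at h1
    simp only [Finset.sum_add_distrib, real_inner_smul_left, ← Finset.mul_sum, mul_add,
      mul_inv_cancel_left₀ hμ.ne', Finset.sum_neg_distrib]
    linarith
  · have h1 := mul_le_mul_of_nonneg_left (hv' i u) (mul_pos hμ (hP.μr_pos i)).le
    rw [two_smul, add_sub_cancel_right, sub_self, inner_zero_left, mul_zero, zero_add, ← mul_add]
    exact h1
  · have h1 := hp i u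
    rw [show (2 : ℝ) • P.L i x - P.L i x + P.μ⁻¹ • p i - P.μ⁻¹ • p i = P.L i x by
      rw [two_smul]; abel, real_inner_smul_left]
    refine le_of_mul_le_mul_left ?_ hμ
    rw [mul_add, mul_inv_cancel_left₀ hμ.ne', ← mul_assoc, ← mul_assoc]
    exact h1
  · rw [show (2 : ℝ) • P.K j x - P.K j x + P.μ⁻¹ • q j - P.μ⁻¹ • q j = P.K j x by
      rw [two_smul]; abel]
    exact hxK j
  · rw [show (2 : ℝ) • P.K j x - P.K j x + P.μ⁻¹ • q j - P.μ⁻¹ • q j = P.K j x by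
      rw [two_smul]; abel, real_inner_smul_left]
    exact mul_nonpos_of_nonneg_of_nonpos (inv_nonneg.2 hμ.le) (hq j c hc)

/-! ### The metric and positivity of the decrease -/

/-- The part of the squared metric that couples `x` with `v i` and `w i`, for `l = L i x`. -/
def metricZ (P : Model X Y Z Z' W) (τ : ℝ) (i : ι) (l b c : Z i) : ℝ :=
  τ * ‖b‖ ^ 2 + P.μ * ‖c‖ ^ 2 - 2 * (P.μ * P.μr i) * inner ℝ (P.B i l) (P.B i b)
    - 2 * P.μ * inner ℝ l c

/-- The part of the squared metric that couples `x` with `z j`, for `l = K j x`. -/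
def metricW (P : Model X Y Z Z' W) (j : κ) (l d : W j) : ℝ :=
  P.μ * ‖d‖ ^ 2 - 2 * P.μ * inner ℝ l d

/-- The squared norm for which the iteration map is averaged. -/
def metric (P : Model X Y Z Z' W) (σ τ : ℝ) (p : X × (∀ i, Z i) × (∀ i, Z i) × (∀ j, W j)) : ℝ :=
  σ * ‖p.1‖ ^ 2 + ∑ i, P.metricZ τ i (P.L i p.1) (p.2.1 i) (p.2.2.1 i)
    + ∑ j, P.metricW j (P.K j p.1) (p.2.2.2 j)

/-- The quadratic form controlling the decrease of the distance to a fixed point. -/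
def decrease (P : Model X Y Z Z' W) (σ τ : ℝ) (p : X × (∀ i, Z i) × (∀ i, Z i) × (∀ j, W j)) : ℝ :=
  P.metric σ τ p - 1 / 2 * inner ℝ (P.Q p.1) p.1
    - 1 / 2 * ∑ i, P.μ * P.μr i * ‖P.B i (p.2.1 i)‖ ^ 2

theorem continuous_metric (P : Model X Y Z Z' W) (σ τ : ℝ) : Continuous (P.metric σ τ) := by
  have hL := fun i => (P.L i).continuous_of_finiteDimensional
  have hB := fun i => (P.B i).continuous_of_finiteDimensional
  have hK := fun j => (P.K j).continuous_of_finiteDimensional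
  unfold metric metricZ metricW
  fun_prop

theorem continuous_decrease (P : Model X Y Z Z' W) (σ τ : ℝ) : Continuous (P.decrease σ τ) := by
  have hQ := P.Q.continuous_of_finiteDimensional
  have hB := fun i => (P.B i).continuous_of_finiteDimensional
  have hm := P.continuous_metric σ τ
  unfold decrease
  fun_prop

theorem metric_smul (P : Model X Y Z Z' W) (σ τ t : ℝ)
    (p : X × (∀ i, Z i) × (∀ i, Z i) × (∀ j, W j)) :
    P.metric σ τ (t • p) = t ^ 2 * P.metric σ τ p := by
  simp only [metric, metricZ, metricW, Prod.smul_fst, Prod.smul_snd, Pi.smul_apply, map_smul,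
    norm_smul, mul_pow, Real.norm_eq_abs, sq_abs, real_inner_smul_left, inner_smul_right,
    mul_add, Finset.mul_sum]
  congr 1
  · congr 1
    · ring
    · exact Finset.sum_congr rfl fun i _ => by ring
  · exact Finset.sum_congr rfl fun i _ => by ring

theorem decrease_smul (P : Model X Y Z Z' W) (σ τ t : ℝ)
    (p : X × (∀ i, Z i) × (∀ i, Z i) × (∀ j, W j)) :
    P.decrease σ τ (t • p) = t ^ 2 * P.decrease σ τ p := by
  simp only [decrease, metric_smul, Prod.smul_fst, Prod.smul_snd, Pi.smul_apply, map_smul,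
    norm_smul, mul_pow, Real.norm_eq_abs, sq_abs, real_inner_smul_left, inner_smul_right,
    mul_sub, Finset.mul_sum]
  congr 1
  · ring
  · exact Finset.sum_congr rfl fun i _ => by ring

theorem decrease_le_metric {P : Model X Y Z Z' W} (hP : P.Setting) (hconv : P.OverallConvexity)
    (σ τ : ℝ) (p : X × (∀ i, Z i) × (∀ i, Z i) × (∀ j, W j)) :
    P.decrease σ τ p ≤ P.metric σ τ p := by
  have hQ : 0 ≤ inner ℝ (P.Q p.1) p.1 := hconv.re_inner_nonneg_left p.1
  have hB : 0 ≤ ∑ i, P.μ * P.μr i * ‖P.B i (p.2.1 i)‖ ^ 2 := Finset.sum_nonneg fun i _ =>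
    mul_nonneg (mul_pos hP.μ_pos (hP.μr_pos i)).le (by positivity)
  unfold decrease
  linarith

/-- Young's inequality with weight `k / 2` bounds the cross term, at the price of `2 / k` copies of
`μ * μr i * ‖B i b‖ ^ 2`; the subtracted forward loss asks for another `1 / 2`. The bound on `τ`
pays for `k / 2 + 2 / k` copies, so a fraction `(k / 2 - 1 / 2) / (k / 2 + 2 / k)` of `τ * ‖b‖ ^ 2`
is left, positive because `1 < k`. The `c` terms are a completed square. -/
theorem Admissible.metricZ_ge {P : Model X Y Z Z' W} (hP : P.Setting) {σ τ k : ℝ}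
    (hpar : P.Admissible σ τ k) (i : ι) (l b c : Z i) :
    (k / 2 - 1 / 2) / (k / 2 + 2 / k) * τ * ‖b‖ ^ 2 + P.μ * ‖c - l‖ ^ 2 - P.μ * ‖l‖ ^ 2
      - k / 2 * (P.μ * (P.μr i * ‖P.B i l‖ ^ 2)) ≤
    P.metricZ τ i l b c - 1 / 2 * (P.μ * P.μr i * ‖P.B i b‖ ^ 2) := by
  have hk : 0 < k := one_pos.trans hpar.one_lt
  set m := P.μ * P.μr i with hm
  have hm0 : 0 < m := mul_pos hP.μ_pos (hP.μr_pos i)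
  set θ := k / 2 + 2 / k with hθ
  have hθ0 : 0 < θ := by positivity
  have hδ : 0 ≤ 1 - (k / 2 - 1 / 2) / θ := by
    rw [sub_nonneg, div_le_one hθ0, hθ]
    have : 0 < 2 / k := by positivity
    linarith
  have hop : ‖P.B i b‖ ^ 2 ≤ ‖(P.B i).toContinuousLinearMap‖ ^ 2 * ‖b‖ ^ 2 := by
    rw [← mul_pow]
    gcongr
    exact (P.B i).toContinuousLinearMap.le_opNorm b
  have hτ : θ * m * ‖P.B i b‖ ^ 2 ≤ τ * ‖b‖ ^ 2 := by
    calc θ * m * ‖P.B i b‖ ^ 2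
        ≤ θ * m * (‖(P.B i).toContinuousLinearMap‖ ^ 2 * ‖b‖ ^ 2) := by gcongr
      _ = P.μ * θ * (P.μr i * ‖(P.B i).toContinuousLinearMap‖ ^ 2) * ‖b‖ ^ 2 := by
          rw [hm]; ring
      _ ≤ τ * ‖b‖ ^ 2 := by
          have := hpar.le_τ i
          gcongr
  have h1 := mul_le_mul_of_nonneg_left hτ hδ
  have h2 : (1 - (k / 2 - 1 / 2) / θ) * (θ * m * ‖P.B i b‖ ^ 2) =
      (2 / k + 1 / 2) * m * ‖P.B i b‖ ^ 2 := by
    have : (1 - (k / 2 - 1 / 2) / θ) * θ = 2 / k + 1 / 2 := by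
      rw [sub_mul, div_mul_cancel₀ _ hθ0.ne', hθ]; ring
    rw [← this]; ring
  rw [h2] at h1
  have h3 : 2 * inner ℝ (P.B i l) (P.B i b) ≤ k / 2 * ‖P.B i l‖ ^ 2 + 2 / k * ‖P.B i b‖ ^ 2 := by
    have h4 : 0 ≤ ‖(k / 2) • P.B i l - P.B i b‖ ^ 2 := by positivity
    rw [norm_sub_sq_real, norm_smul, mul_pow, Real.norm_eq_abs, sq_abs, real_inner_smul_left] at h4
    have h5 := mul_nonneg (show 0 ≤ 2 / k by positivity) h4
    have h6 : 2 / k * ((k / 2) ^ 2 * ‖P.B i l‖ ^ 2 - 2 * (k / 2 * inner ℝ (P.B i l) (P.B i b)) +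
        ‖P.B i b‖ ^ 2) = k / 2 * ‖P.B i l‖ ^ 2 - 2 * inner ℝ (P.B i l) (P.B i b) +
        2 / k * ‖P.B i b‖ ^ 2 := by
      field_simp
    linarith
  have h7 := mul_le_mul_of_nonneg_left h3 hm0.le
  rw [norm_sub_sq_real, real_inner_comm]
  unfold metricZ
  rw [← hm, ← mul_assoc P.μ, ← hm]
  linarith

theorem Admissible.decrease_pos {P : Model X Y Z Z' W} (hP : P.Setting)
    (hconv : P.OverallConvexity) {σ τ k : ℝ} (hpar : P.Admissible σ τ k)
    (p : X × (∀ i, Z i) × (∀ i, Z i) × (∀ j, W j)) (hp : p ≠ 0) : 0 < P.decrease σ τ p := by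
  obtain ⟨a, b, c, d⟩ := p
  have hk : 0 < k := one_pos.trans hpar.one_lt
  have hμ := hP.μ_pos
  set δ := (k / 2 - 1 / 2) / (k / 2 + 2 / k) * τ with hδ
  have hδ0 : 0 < δ :=
    mul_pos (div_pos (by linarith [hpar.one_lt]) (by positivity)) hpar.τ_pos
  set G := inner ℝ ((σ • LinearMap.id - (k / 2) • (P.A.adjoint ∘ₗ P.A) -
    P.μ • (∑ i, (P.L i).adjoint ∘ₗ P.L i + ∑ j, (P.K j).adjoint ∘ₗ P.K j) : X →ₗ[ℝ] X) a) a with hG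
  have hGeq : G = σ * ‖a‖ ^ 2 - k / 2 * ‖P.A a‖ ^ 2 -
      (∑ i, P.μ * ‖P.L i a‖ ^ 2 + ∑ j, P.μ * ‖P.K j a‖ ^ 2) := by
    simp only [hG, LinearMap.sub_apply, LinearMap.smul_apply, LinearMap.add_apply,
      LinearMap.sum_apply, LinearMap.comp_apply, LinearMap.id_apply, inner_sub_left,
      inner_add_left, real_inner_smul_left, sum_inner, LinearMap.adjoint_inner_left,
      real_inner_self_eq_norm_sq, Finset.mul_sum, mul_add]
  have hQ : 0 ≤ inner ℝ (P.Q a) a := hconv.re_inner_nonneg_left a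
  have hQeq : inner ℝ (P.Q a) a = ‖P.A a‖ ^ 2 -
      ∑ i, P.μ * (P.μr i * ‖P.B i (P.L i a)‖ ^ 2) := by
    rw [inner_Q, real_inner_self_eq_norm_sq, Finset.mul_sum]
    simp only [real_inner_self_eq_norm_sq]
  have hZ := Finset.sum_le_sum fun i (_ : i ∈ Finset.univ) =>
    hpar.metricZ_ge hP i (P.L i a) (b i) (c i)
  have hW : ∑ j, P.metricW j (P.K j a) (d j) =
      ∑ j, P.μ * ‖d j - P.K j a‖ ^ 2 - ∑ j, P.μ * ‖P.K j a‖ ^ 2 := by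
    rw [← Finset.sum_sub_distrib]
    refine Finset.sum_congr rfl fun j _ => ?_
    rw [norm_sub_sq_real, real_inner_comm]
    unfold metricW
    ring
  simp only [Finset.sum_sub_distrib, Finset.sum_add_distrib, ← Finset.mul_sum (a := k / 2),
    ← Finset.mul_sum (a := (1 / 2 : ℝ)), ← hδ] at hZ
  have hlow : G + ∑ i, δ * ‖b i‖ ^ 2 + ∑ i, P.μ * ‖c i - P.L i a‖ ^ 2 +
      ∑ j, P.μ * ‖d j - P.K j a‖ ^ 2 ≤ P.decrease σ τ (a, b, c, d) := by
    -- The Young terms in `B i (L i a)` sum to `k / 2` times `‖A a‖ ^ 2 - ⟪Q a, a⟫`. After the loss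
    -- of half of `⟪Q a, a⟫`, this nonnegative multiple remains and is dropped.
    have hk2 : 0 ≤ (k / 2 - 1 / 2) * inner ℝ (P.Q a) a :=
      mul_nonneg (by linarith [hpar.one_lt]) hQ
    simp only [decrease, metric]
    rw [hW, hGeq]
    rw [hQeq] at hk2 ⊢
    linarith
  have hb0 : ∀ i ∈ Finset.univ, 0 ≤ δ * ‖b i‖ ^ 2 := fun i _ => by positivity
  have hc0 : ∀ i ∈ Finset.univ, 0 ≤ P.μ * ‖c i - P.L i a‖ ^ 2 := fun i _ => by positivity
  have hd0 : ∀ j ∈ Finset.univ, 0 ≤ P.μ * ‖d j - P.K j a‖ ^ 2 := fun j _ => by positivity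
  have hb1 := Finset.sum_nonneg hb0
  have hc1 := Finset.sum_nonneg hc0
  have hd1 := Finset.sum_nonneg hd0
  by_contra! hneg
  by_cases ha : a = 0
  · subst ha
    have hG0 : G = 0 := by rw [hG]; simp
    have hb2 := (Finset.sum_eq_zero_iff_of_nonneg hb0).1 (by linarith)
    have hc2 := (Finset.sum_eq_zero_iff_of_nonneg hc0).1 (by linarith)
    have hd2 := (Finset.sum_eq_zero_iff_of_nonneg hd0).1 (by linarith)
    apply hp
    refine Prod.ext rfl (Prod.ext (funext fun i => ?_) (Prod.ext (funext fun i => ?_)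
      (funext fun j => ?_)))
    · simpa [hδ0.ne'] using hb2 i (Finset.mem_univ i)
    · simpa [hμ.ne'] using hc2 i (Finset.mem_univ i)
    · simpa [hμ.ne'] using hd2 j (Finset.mem_univ j)
  · have := hpar.posDef.2 a ha
    rw [← hG] at this
    linarith

/-! ### Fejér monotonicity -/

/-- Unprimed arguments are the old point and primed ones the new point, both relative to a fixed
point; `hb` and `hc` are monotonicity of the subdifferentials. The loss with factor `1 / 2` comes
from `4 ⟪B b, B b'⟫ + ‖B (b - b')‖ ^ 2 = ‖B b + B b'‖ ^ 2 ≥ 0`. The last term on the left cancels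
later against the primal inequality. -/
theorem le_metricZ_sub {P : Model X Y Z Z' W} (hP : P.Setting) {τ : ℝ} (i : ι)
    (l l' b b' c c' : Z i)
    (hb : 0 ≤ τ * inner ℝ (b - b') b' +
      P.μ * P.μr i * inner ℝ (P.B i ((2 : ℝ) • l' - l) - P.B i b) (P.B i b'))
    (hc : 0 ≤ inner ℝ c' ((2 : ℝ) • l' - l + c - c')) :
    P.metricZ τ i (l - l') (b - b') (c - c') - 1 / 2 * (P.μ * P.μr i * ‖P.B i (b - b')‖ ^ 2) -
      2 * (P.μ * (P.μr i * inner ℝ (P.B i b) (P.B i l') + inner ℝ c l')) ≤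
      P.metricZ τ i l b c - P.metricZ τ i l' b' c' := by
  have hm0 : 0 < P.μ * P.μr i := mul_pos hP.μ_pos (hP.μr_pos i)
  have h1 : 0 ≤ P.μ * P.μr i * ‖P.B i b + P.B i b'‖ ^ 2 := by positivity
  have h2 := mul_nonneg hP.μ_pos.le hc
  rw [norm_add_sq_real] at h1
  unfold metricZ
  simp only [map_sub, map_smul, inner_sub_left, inner_sub_right, inner_add_right,
    real_inner_smul_left, inner_smul_right, norm_sub_sq_real, real_inner_self_eq_norm_sq] at *
  rw [real_inner_comm c' c, real_inner_comm (P.B i b) (P.B i l'), real_inner_comm c l'] at *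
  rw [real_inner_comm l' c', real_inner_comm l c'] at h2
  linarith

theorem le_metricW_sub {P : Model X Y Z Z' W} (hP : P.Setting) (j : κ) (l l' d d' : W j)
    (hd : 0 ≤ inner ℝ d' ((2 : ℝ) • l' - l + d - d')) :
    P.metricW j (l - l') (d - d') - 2 * (P.μ * inner ℝ d l') ≤
      P.metricW j l d - P.metricW j l' d' := by
  have h2 := mul_nonneg hP.μ_pos.le hd
  unfold metricW
  simp only [inner_sub_left, inner_sub_right, inner_add_right,
    inner_smul_right, norm_sub_sq_real, real_inner_self_eq_norm_sq] at *
  rw [real_inner_comm d d', real_inner_comm l' d', real_inner_comm l d'] at h2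
  rw [real_inner_comm l' d]
  linarith

theorem force_sub (P : Model X Y Z Z' W) (x x' : X) (v v' w w' : ∀ i, Z i) (z z' : ∀ j, W j)
    (d : X) :
    inner ℝ (P.force x v w z - P.force x' v' w' z') d = inner ℝ (P.Q (x - x')) d +
      ∑ i, P.μ * (P.μr i * inner ℝ (P.B i (v i - v' i)) (P.B i (P.L i d)) +
        inner ℝ (w i - w' i) (P.L i d)) + ∑ j, P.μ * inner ℝ (z j - z' j) (P.K j d) := by
  simp only [force, inner_add_left, inner_sub_left, real_inner_smul_left, sum_inner,
    LinearMap.adjoint_inner_left, map_sub, Finset.sum_add_distrib, ← Finset.mul_sum,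
    Finset.sum_sub_distrib, mul_sub]
  ring

/-- The iteration map is Fejér monotone towards stationary points. -/
theorem IsStep.metric_le {P : Model X Y Z Z' W} (hP : P.Setting) (hconv : P.OverallConvexity)
    {σ τ : ℝ} {x ξ x₀ : X} {v w ζ η v₀ w₀ : ∀ i, Z i} {z ς z₀ : ∀ j, W j}
    (h : P.IsStep σ τ x v w z ξ ζ η ς) (h₀ : P.IsStep σ τ x₀ v₀ w₀ z₀ x₀ v₀ w₀ z₀) :
    P.metric σ τ ((ξ, ζ, η, ς) - (x₀, v₀, w₀, z₀)) ≤
      P.metric σ τ ((x, v, w, z) - (x₀, v₀, w₀, z₀)) -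
        P.decrease σ τ ((x, v, w, z) - (ξ, ζ, η, ς)) := by
  have hz : ∀ j, (2 : ℝ) • P.K j x₀ - P.K j x₀ + z₀ j - z₀ j = P.K j x₀ := fun j => by
    rw [two_smul]; abel
  have hw : ∀ i, (2 : ℝ) • P.L i x₀ - P.L i x₀ + w₀ i - w₀ i = P.L i x₀ := fun i => by
    rw [two_smul]; abel
  have hX : inner ℝ (P.Q (x - x₀)) (ξ - x₀) +
      ∑ i, P.μ * (P.μr i * inner ℝ (P.B i (v i - v₀ i)) (P.B i (P.L i (ξ - x₀))) +
        inner ℝ (w i - w₀ i) (P.L i (ξ - x₀))) +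
      ∑ j, P.μ * inner ℝ (z j - z₀ j) (P.K j (ξ - x₀)) ≤ σ * inner ℝ (x - ξ) (ξ - x₀) := by
    have h1 := h.inner_le x₀ h₀.mem
    have h2 := h₀.inner_le ξ h.mem
    rw [← force_sub, inner_sub_left]
    rw [← neg_sub ξ x₀, inner_neg_right, inner_sub_left, real_inner_smul_left] at h1
    rw [sub_self, smul_zero, zero_sub, inner_neg_left] at h2
    linarith
  have hZ : ∀ i, P.metricZ τ i (P.L i (x - ξ)) (v i - ζ i) (w i - η i) -
      1 / 2 * (P.μ * P.μr i * ‖P.B i (v i - ζ i)‖ ^ 2) -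
      2 * (P.μ * (P.μr i * inner ℝ (P.B i (v i - v₀ i)) (P.B i (P.L i (ξ - x₀))) +
        inner ℝ (w i - w₀ i) (P.L i (ξ - x₀)))) ≤
      P.metricZ τ i (P.L i (x - x₀)) (v i - v₀ i) (w i - w₀ i) -
        P.metricZ τ i (P.L i (ξ - x₀)) (ζ i - v₀ i) (η i - w₀ i) := by
    intro i
    have key := le_metricZ_sub hP (τ := τ) i (P.L i (x - x₀)) (P.L i (ξ - x₀)) (v i - v₀ i)
      (ζ i - v₀ i) (w i - w₀ i) (η i - w₀ i) ?_ ?_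
    · rw [← map_sub (P.L i), sub_sub_sub_cancel_right, sub_sub_sub_cancel_right,
        sub_sub_sub_cancel_right] at key
      exact key
    · have h1 := h.le_v i (v₀ i)
      have h2 := h₀.le_v i (ζ i)
      rw [two_smul, add_sub_cancel_right, sub_self, inner_zero_left, mul_zero, zero_add] at h2
      rw [← neg_sub (ζ i) (v₀ i), map_neg, inner_neg_right, inner_neg_right] at h1
      have h3 : P.B i ((2 : ℝ) • P.L i (ξ - x₀) - P.L i (x - x₀)) - P.B i (v i - v₀ i) =
          (P.B i (P.L i ((2 : ℝ) • ξ - x)) - P.B i (v i)) -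
            (P.B i (P.L i x₀) - P.B i (v₀ i)) := by
        simp only [map_sub, map_add, two_smul]
        abel
      rw [h3, sub_sub_sub_cancel_right, inner_sub_left (P.B i _ - P.B i _)]
      linarith
    · have h1 := h.le_w i (P.L i x₀)
      have h2 := h₀.le_w i ((2 : ℝ) • P.L i ξ - P.L i x + w i - η i)
      rw [hw] at h2
      have h3 : (2 : ℝ) • P.L i (ξ - x₀) - P.L i (x - x₀) + (w i - w₀ i) - (η i - w₀ i) =
          ((2 : ℝ) • P.L i ξ - P.L i x + w i - η i) - P.L i x₀ := by
        simp only [map_sub, two_smul]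
        abel
      rw [h3, inner_sub_left]
      rw [← neg_sub _ (P.L i x₀), inner_neg_right] at h1
      linarith
  have hW : ∀ j, P.metricW j (P.K j (x - ξ)) (z j - ς j) -
      2 * (P.μ * inner ℝ (z j - z₀ j) (P.K j (ξ - x₀))) ≤
      P.metricW j (P.K j (x - x₀)) (z j - z₀ j) -
        P.metricW j (P.K j (ξ - x₀)) (ς j - z₀ j) := by
    intro j
    have key := le_metricW_sub hP j (P.K j (x - x₀)) (P.K j (ξ - x₀)) (z j - z₀ j)
      (ς j - z₀ j) ?_
    · rw [← map_sub (P.K j), sub_sub_sub_cancel_right, sub_sub_sub_cancel_right] at key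
      exact key
    · have h1 := h.le_z j (P.K j x₀) (by simpa only [hz] using h₀.mem_z j)
      have h2 := h₀.le_z j _ (h.mem_z j)
      rw [hz] at h2
      have h3 : (2 : ℝ) • P.K j (ξ - x₀) - P.K j (x - x₀) + (z j - z₀ j) - (ς j - z₀ j) =
          ((2 : ℝ) • P.K j ξ - P.K j x + z j - ς j) - P.K j x₀ := by
        simp only [map_sub, two_smul]
        abel
      rw [h3, inner_sub_left]
      rw [← neg_sub _ (P.K j x₀), inner_neg_right] at h1
      linarith
  -- Cocoercivity of `Q`: the sum equals the form `⟪Q u, u⟫` at `u = (x - x₀) + (ξ - x₀)`. It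
  -- accounts for `Q` being evaluated at `x` rather than at `ξ`.
  have hQ : 0 ≤ inner ℝ (P.Q (x - ξ)) (x - ξ) + 4 * inner ℝ (P.Q (x - x₀)) (ξ - x₀) := by
    have h1 : 0 ≤ inner ℝ (P.Q ((x - x₀) + (ξ - x₀))) ((x - x₀) + (ξ - x₀)) :=
      hconv.re_inner_nonneg_left _
    have h2 : inner ℝ (P.Q (ξ - x₀)) (x - x₀) = inner ℝ (P.Q (x - x₀)) (ξ - x₀) := by
      rw [hconv.isSymmetric, real_inner_comm]
    rw [← sub_sub_sub_cancel_right x ξ x₀]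
    simp only [map_add, map_sub P.Q (x - x₀), inner_add_left, inner_add_right, inner_sub_left,
      inner_sub_right (x := P.Q _) (y := x - x₀), h2] at h1 ⊢
    linarith
  have hσ : σ * ‖x - x₀‖ ^ 2 = σ * ‖ξ - x₀‖ ^ 2 + σ * ‖x - ξ‖ ^ 2 +
      2 * (σ * inner ℝ (x - ξ) (ξ - x₀)) := by
    rw [← sub_add_sub_cancel x ξ x₀, norm_add_sq_real]
    ring
  have hZs := Finset.sum_le_sum fun i (_ : i ∈ Finset.univ) => hZ i
  have hWs := Finset.sum_le_sum fun j (_ : j ∈ Finset.univ) => hW j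
  simp only [Finset.sum_sub_distrib, ← Finset.mul_sum (a := (2 : ℝ)),
    ← Finset.mul_sum (a := (1 / 2 : ℝ))] at hZs hWs
  simp only [decrease, metric, Prod.mk_sub_mk, Pi.sub_apply]
  linarith

end Model

end EALiGME

end

/-! ### Convergence of the iterates -/

theorem theorem1 {ι κ : Type*} [Fintype ι] [Fintype κ]
    {X Y : Type*} {Z Z' : ι → Type*} {W : κ → Type*}
    [NormedAddCommGroup X] [InnerProductSpace ℝ X] [FiniteDimensional ℝ X]
    [NormedAddCommGroup Y] [InnerProductSpace ℝ Y] [FiniteDimensional ℝ Y]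
    [∀ i, NormedAddCommGroup (Z i)] [∀ i, InnerProductSpace ℝ (Z i)]
    [∀ i, FiniteDimensional ℝ (Z i)]
    [∀ i, NormedAddCommGroup (Z' i)] [∀ i, InnerProductSpace ℝ (Z' i)]
    [∀ i, FiniteDimensional ℝ (Z' i)]
    [∀ j, NormedAddCommGroup (W j)] [∀ j, InnerProductSpace ℝ (W j)]
    [∀ j, FiniteDimensional ℝ (W j)]
    (P : EALiGME.Model X Y Z Z' W) (hP : P.Setting) (hconv : P.OverallConvexity)
    (σ τ k : ℝ) (hpar : P.Admissible σ τ k)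
    (h : ℕ → X × (∀ i, Z i) × (∀ i, Z i) × (∀ j, W j))
    (h_zero : (h 0).1 ∈ P.C₀)
    (h_succ : ∀ n, h (n + 1) = P.T σ τ (h n)) :
    (∀ n, (h n).1 ∈ P.C₀) ∧
    (P.Qualified → P.solutions.Nonempty →
      ∃ x ∈ P.solutions, Tendsto (fun n => (h n).1) atTop (𝓝 x)) := by
  have hstep := EALiGME.Model.isStep_T hP hpar.σ_pos hpar.τ_pos
  refine ⟨fun n => ?_, fun hqual hsol => ?_⟩
  · cases n with
    | zero => exact h_zero
    | succ n =>
      rw [h_succ]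
      exact (hstep (h n)).mem
  obtain ⟨x, hx⟩ := hsol
  obtain ⟨v, w, z, hfix⟩ := EALiGME.Model.exists_isStep_of_mem_solutions hP hqual hx σ τ
  obtain ⟨c, hc, hcR⟩ := exists_pos_mul_norm_sq_le (P.continuous_decrease σ τ)
    (P.decrease_smul σ τ) (hpar.decrease_pos hP hconv)
  have hstat : ∀ p, P.T σ τ p = p →
      P.IsStep σ τ p.1 p.2.1 p.2.2.1 p.2.2.2 p.1 p.2.1 p.2.2.1 p.2.2.2 := fun p hp => by
    have := hstep p
    rwa [hp] at this
  obtain ⟨p, hp, hlim⟩ := exists_tendsto_fixedPoint (EALiGME.Model.continuous_T hP hpar.τ_pos)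
    (P.continuous_metric σ τ) (by simpa using P.metric_smul σ τ 0 0) hc
    (fun p => (hcR p).trans (EALiGME.Model.decrease_le_metric hP hconv σ τ p)) hcR
    (fun p s hs => (hstep p).metric_le hP hconv (hstat s hs))
    ⟨_, hfix.T_eq hP hpar.σ_pos hpar.τ_pos⟩ h_succ
  exact ⟨p.1, (hstat p hp).mem_solutions hP hconv, (continuous_fst.tendsto p).comp hlim⟩
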